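/- Let $(X,Y)$ be a random vector with joint law $P_{XY}$ on a product $\mathcal X\times\mathcal Y$ of measurable spaces, and let $P_X$ be the law of $X$. Let $r\ge 1$ be a fixed integer and let $\ell:\mathcal Y^r\to\mathbb R$ be a measurable function that is symmetric in its arguments. With $Y_1,\dots,Y_r$ i.i.d. copies of $Y$, put $$\psi=\mathbb E[\ell(Y_1,\dots,Y_r)],\qquad \ell_1(y)=\mathbb E[\ell(y,Y_2,\dots,Y_r)],\qquad \psi_1(X)=\mathbb E[\ell_1(Y)\mid X].$$ Let $(m_n)_{n\ge 0}$ be an arbitrary sequence of non-negative integers, and write $m=m_n$. For each $n$ one observes $n$ i.i.d. labeled pairs $(X_1,Y_1),\dots,(X_n,Y_n)$ from $P_{XY}$ and, independently of them, $m$ i.i.d. unlabeled points $X_{n+1},\dots,X_{n+m}$ from $P_X$. Fold 1 consists of $(X_i,Y_i)$, $1\le i\le\lfloor n/2\rfloor$, and $X_i$, $n+1\le i\le n+\lfloor m/2\rfloor$; fold 2 consists of all the remaining observations. For $k=1,2$ let $\widehat f_k:\mathcal X\to\mathbb R$ be a predictor trained on fold $k$, that is, $\widehat f_k(x)$ is a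 jointly measurable function of $x$, of the observations in fold $k$, and possibly of an auxiliary random element that is independent of all the data (and may be shared by the two predictors). Let $\widehat f_{\mathrm{cross}}(X_i)=\widehat f_2(X_i)$ if the index $i$ belongs to fold 1 and $\widehat f_{\mathrm{cross}}(X_i)=\widehat f_1(X_i)$ if it belongs to fold 2. Let $U$ be the classical U-statistic, i.e. the average of $\ell(Y_{i_1},\dots,Y_{i_r})$ over all $r$-tuples of distinct indices in $\{1,\dots,n\}$, and define $$U_{\mathrm{cross}}=U-\frac rn\sum_{i=1}^n\widehat f_{\mathrm{cross}}(X_i)+\frac r{n+m}\sum_{i=1}^{n+m}\widehat f_{\mathrm{cross}}(X_i).$$ For $f:\mathcal X\to\mathbb R$ measurable with $\mathrm{Var}\{f(X)\}<\infty$ put $$\Lambda_{n,m,f}=r^2\,\mathrm{Var}\{\ell_1(Y)\}+\frac{r^2m}{n+m}\bigl[\mathrm{Var}\{f(X)\}-2\,\mathrm{Cov}\{f(X),\psi_1(X)\}\bigr].$$ **Theorem.** Assume that $\mathrm{Var}\{\ell(Y_1,\dots,Y_r)\}<\infty$ and $\mathbb E[\mathrm{Var}\{\ell_1(Y)\mid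 X\}]>0$, and that there is a fixed function $f$ with $\mathrm{Var}\{f(X)\}<\infty$ such that, as $n\to\infty$, $$\mathbb E[\{\widehat f_1(X)-f(X)\}^2]\to 0\quad\text{and}\quad \mathbb E[\{\widehat f_2(X)-f(X)\}^2]\to 0,$$ where $X\sim P_X$ is independent of the data and of the auxiliary randomness. Then, as $n\to\infty$, $$\frac{\sqrt n\,(U_{\mathrm{cross}}-\psi)}{\sqrt{\Lambda_{n,m,f}}}\xrightarrow{\ d\ }N(0,1)\qquad\text{and}\qquad \frac{\mathbb E\{(U_{\mathrm{cross}}-\psi)^2\}}{n^{-1}\Lambda_{n,m,f}}\to 1 .$$ -/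

import Mathlib

open MeasureTheory ProbabilityTheory Filter Topology

noncomputable section

namespace SemiSupU

/-! ### Population quantities

`P` is the joint law of `(X, Y)` on `𝒳 × 𝒴`, with marginals `P.fst` and `P.snd`. A kernel of
order `r` is a function `ℓ : (Fin r → 𝒴) → ℝ`. -/

section Population

variable {𝒳 𝒴 : Type*} [MeasurableSpace 𝒳] [MeasurableSpace 𝒴] {r : ℕ}

/-- Symmetry of the kernel in its arguments. -/
def IsSymmetricKernel (ℓ : (Fin r → 𝒴) → ℝ) : Prop :=
  ∀ (σ : Equiv.Perm (Fin r)) (y : Fin r → 𝒴), ℓ (fun i => y (σ i)) = ℓ y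

/-- The joint law of `r` i.i.d. responses `Y₁, …, Y_r`. -/
def responseLaw (P : Measure (𝒳 × 𝒴)) (r : ℕ) : Measure (Fin r → 𝒴) :=
  Measure.pi fun _ => P.snd

/-- The target parameter `ψ = E[ℓ(Y₁, …, Y_r)]`. -/
def psi (P : Measure (𝒳 × 𝒴)) (ℓ : (Fin r → 𝒴) → ℝ) : ℝ :=
  ∫ v, ℓ v ∂(responseLaw P r)

/-- The projection `ℓ₁(y) = E[ℓ(Y₁, …, Y_r) | Y₁ = y] = E[ℓ(y, Y₂, …, Y_r)]`: the first argument
is set to `y` and the others are averaged out. -/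
def ell1 [NeZero r] (P : Measure (𝒳 × 𝒴)) (ℓ : (Fin r → 𝒴) → ℝ) (y : 𝒴) : ℝ :=
  ∫ v, ℓ (Function.update v 0 y) ∂(responseLaw P r)

/-- The random variable `ℓ₁(Y)`, on the probability space `(𝒳 × 𝒴, P)` carrying `(X, Y)`. -/
def ell1Y [NeZero r] (P : Measure (𝒳 × 𝒴)) (ℓ : (Fin r → 𝒴) → ℝ) : 𝒳 × 𝒴 → ℝ :=
  fun z => ell1 P ℓ z.2

/-- The σ-algebra `σ(X)` on `𝒳 × 𝒴`. -/
abbrev sigmaX : MeasurableSpace (𝒳 × 𝒴) :=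
  MeasurableSpace.comap Prod.fst inferInstance

/-- The random variable `ψ₁(X) = E[ℓ₁(Y) | X]`, on the probability space `(𝒳 × 𝒴, P)`. -/
def psi1X [NeZero r] (P : Measure (𝒳 × 𝒴)) (ℓ : (Fin r → 𝒴) → ℝ) : 𝒳 × 𝒴 → ℝ :=
  P[ell1Y P ℓ | sigmaX]

/-- The expected conditional variance `E[Var(ℓ₁(Y) | X)]`. -/
def expCondVar [NeZero r] (P : Measure (𝒳 × 𝒴)) (ℓ : (Fin r → 𝒴) → ℝ) : ℝ :=
  ∫ z, (Var[ell1Y P ℓ; P | sigmaX]) z ∂P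

/-- `Λ_{n,m,f} = r² Var(ℓ₁(Y)) + (r² m / (n + m)) (Var(f(X)) - 2 Cov(f(X), ψ₁(X)))`. -/
def Lam [NeZero r] (P : Measure (𝒳 × 𝒴)) (ℓ : (Fin r → 𝒴) → ℝ) (f : 𝒳 → ℝ) (n m : ℕ) : ℝ :=
  (r : ℝ) ^ 2 * Var[ell1Y P ℓ; P]
    + (r : ℝ) ^ 2 * (m : ℝ) / ((n : ℝ) + (m : ℝ))
      * (Var[fun z => f z.1; P] - 2 * cov[fun z => f z.1, psi1X P ℓ; P])

end Population

/-! ### Samples and predictors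

Labeled data `Z : Fin n → Ω → 𝒳 × 𝒴`, unlabeled data `W : Fin m → Ω → 𝒳`, and auxiliary
randomness `ξ : Ω → Θ` that a training algorithm may use (`Θ` may be a one-point space). -/

section Sample

variable {Ω 𝒳 𝒴 Θ : Type*} [MeasurableSpace Ω] [MeasurableSpace 𝒳] [MeasurableSpace 𝒴]
  [MeasurableSpace Θ] {n m r : ℕ}

/-- `Z` is an i.i.d. sample from `P`, `W` is an i.i.d. sample from the marginal law `P.fst`,
the two samples are independent, and `ξ` is independent of the whole data set. -/
structure IsSemiSupervisedSample (μ : Measure Ω) (P : Measure (𝒳 × 𝒴))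
    (Z : Fin n → Ω → 𝒳 × 𝒴) (W : Fin m → Ω → 𝒳) (ξ : Ω → Θ) : Prop where
  measurable_labeled : ∀ i, Measurable (Z i)
  measurable_unlabeled : ∀ j, Measurable (W j)
  measurable_seed : Measurable ξ
  law_labeled : ∀ i, μ.map (Z i) = P
  law_unlabeled : ∀ j, μ.map (W j) = P.fst
  indep_labeled : iIndepFun Z μ
  indep_unlabeled : iIndepFun W μ
  indep_labeled_unlabeled : IndepFun (fun ω i => Z i ω) (fun ω j => W j ω) μ
  indep_data_seed : IndepFun (fun ω => ((fun i => Z i ω), (fun j => W j ω))) ξ μ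

/-- The first fold `D_{XY,1} ∪ D_{X,1}`: the first `⌊n/2⌋` labeled and the first `⌊m/2⌋`
unlabeled observations. -/
def fold1 (Z : Fin n → Ω → 𝒳 × 𝒴) (W : Fin m → Ω → 𝒳) (ω : Ω) :
    ({i : Fin n // i.val < n / 2} → 𝒳 × 𝒴) × ({j : Fin m // j.val < m / 2} → 𝒳) :=
  (fun i => Z i ω, fun j => W j ω)

/-- The second fold `D_{XY,2} ∪ D_{X,2}`: the remaining observations. -/
def fold2 (Z : Fin n → Ω → 𝒳 × 𝒴) (W : Fin m → Ω → 𝒳) (ω : Ω) :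
    ({i : Fin n // n / 2 ≤ i.val} → 𝒳 × 𝒴) × ({j : Fin m // m / 2 ≤ j.val} → 𝒳) :=
  (fun i => Z i ω, fun j => W j ω)

/-- The random function `fhat ω : 𝒳 → ℝ` is trained on `T`: it is the output of a (jointly
measurable) algorithm whose only input is `T ω`. -/
def IsTrainedOn {α : Type*} [MeasurableSpace α] (T : Ω → α) (fhat : Ω → 𝒳 → ℝ) : Prop :=
  ∃ A : α → 𝒳 → ℝ, Measurable (Function.uncurry A) ∧ ∀ ω x, fhat ω x = A (T ω) x

/-- The mean squared prediction error `E[(fhat(X) - f(X))²]`, with `X ∼ P.fst` independent of the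
data on which `fhat` is trained. -/
def mspe (μ : Measure Ω) (P : Measure (𝒳 × 𝒴)) (fhat : Ω → 𝒳 → ℝ) (f : 𝒳 → ℝ) : ENNReal :=
  ∫⁻ ω, ∫⁻ x, ENNReal.ofReal ((fhat ω x - f x) ^ 2) ∂P.fst ∂μ

/-- The classical U-statistic: the average of `ℓ` over all `r`-tuples of distinct indices. -/
def uStat (ℓ : (Fin r → 𝒴) → ℝ) (Z : Fin n → Ω → 𝒳 × 𝒴) (ω : Ω) : ℝ :=
  (n.descFactorial r : ℝ)⁻¹ * ∑ e : Fin r ↪ Fin n, ℓ (fun k => (Z (e k) ω).2)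

/-- `fhat_cross` at the covariate of the labeled observation `i`: the predictor trained on the
opposite fold is used. -/
def crossLabeled (Z : Fin n → Ω → 𝒳 × 𝒴) (fhat1 fhat2 : Ω → 𝒳 → ℝ) (i : Fin n) (ω : Ω) : ℝ :=
  if i.val < n / 2 then fhat2 ω (Z i ω).1 else fhat1 ω (Z i ω).1

/-- `fhat_cross` at the unlabeled observation `j`: the predictor trained on the opposite fold is
used. -/
def crossUnlabeled (W : Fin m → Ω → 𝒳) (fhat1 fhat2 : Ω → 𝒳 → ℝ) (j : Fin m) (ω : Ω) : ℝ :=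
  if j.val < m / 2 then fhat2 ω (W j ω) else fhat1 ω (W j ω)

/-- The cross-fitted semi-supervised U-statistic `U_cross`. -/
def uCross (ℓ : (Fin r → 𝒴) → ℝ) (Z : Fin n → Ω → 𝒳 × 𝒴) (W : Fin m → Ω → 𝒳)
    (fhat1 fhat2 : Ω → 𝒳 → ℝ) (ω : Ω) : ℝ :=
  uStat ℓ Z ω
    - (r : ℝ) / (n : ℝ) * (∑ i, crossLabeled Z fhat1 fhat2 i ω)
    + (r : ℝ) / ((n : ℝ) + (m : ℝ))
      * ((∑ i, crossLabeled Z fhat1 fhat2 i ω) + (∑ j, crossUnlabeled W fhat1 fhat2 j ω))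

end Sample

end SemiSupU

end

open MeasureTheory ProbabilityTheory Filter Topology

noncomputable section

namespace SemiSupU

/-! ### Characteristic functions of powers and a Lindeberg-type estimate -/

/-! Write λ = m/(n+m), s² = Λ and e = E f(X). Replacing both predictors by `f`, and the U-statistic
by its first-order Hoeffding projection, turns √n (U_cross − ψ)/s into a linear statistic of two
independent i.i.d. samples, M = n^(-1/2) Σ (r/s)(ℓ₁(Y_i) − ψ − λ(f(X_i) − e)) + √n/(n+m) Σ
(r/s)(f(X_{n+j}) − e). Its variance is exactly 1 (`Lam_eq`), because the unlabeled sum contributes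
the factor mn/(n+m)² = λ(1−λ). Both conclusions follow once M is asymptotically normal and the
remainder tends to zero in L² (`clt_and_second_moment_of_negligible`).

Neither m nor λ has to converge. By the law of total variance Λ ≥ r² E[Var(ℓ₁(Y)|X)] (`Lam_ge`), so
r/s is bounded and the summands of M are dominated by fixed square-integrable functions. A
second-order expansion, with its error controlled by dominated convergence, compares each sample's
characteristic function with a Gaussian one whose variance depends on n
(`tendsto_charFun_pow_sub_exp`). The two variances add up to 1, so the product of the Gaussian
factors is e^(-t²/2) for every n ≥ 1.

The remainder consists of a degenerate U-statistic and one cross-fitting error per fold. In the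
former, kernels at index tuples sharing at most one index are orthogonal, and pairs of tuples
sharing two indices are a fraction O(n⁻²) of all pairs (`integral_sq_sum_le_of_degenerate`). For the
latter, condition on the training fold and the seed: the evaluation points are then i.i.d., so the
centred sums have second moment controlled by the prediction error, while the conditional means
nearly cancel because a fold holds about half of each sample (`lintegral_sq_fold_error_le`,
`crossfit_weight_le`). The three pieces are bounded separately, so their mutual dependence is
irrelevant. -/

lemma norm_exp_mul_I_sub_taylor_two_le (x : ℝ) :
    ‖Complex.exp (x * Complex.I) - (1 + x * Complex.I - x ^ 2 / 2)‖ ≤ 4 * (x ^ 2 * min 1 |x|) := by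
  rcases le_total |x| 1 with h | h
  · rw [min_eq_right h]
    have h3 := Complex.norm_exp_sub_sum_le_norm_mul_exp (x * Complex.I) 3
    have hn : ‖(x : ℂ) * Complex.I‖ = |x| := by simp
    have hs : ∑ k ∈ Finset.range 3, ((x : ℂ) * Complex.I) ^ k / (k.factorial : ℂ)
        = 1 + x * Complex.I - x ^ 2 / 2 := by
      simp [Finset.sum_range_succ, mul_pow, Nat.factorial]
      ring
    rw [hs, hn] at h3
    refine h3.trans ?_
    -- On |x| ≤ 1 the third-order remainder costs a factor e < 4. On |x| ≥ 1 the crude bound 2 + |x|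
    -- + x²/2 ≤ 4x² suffices, so the constant 4 serves both regimes.
    have he : Real.exp |x| ≤ 4 :=
      (Real.exp_le_exp.2 h).trans (Real.exp_one_lt_d9.le.trans (by norm_num))
    have : |x| ^ 3 = x ^ 2 * |x| := by rw [pow_succ, sq_abs]
    rw [this]
    have h0 : 0 ≤ x ^ 2 * |x| := by positivity
    nlinarith
  · rw [min_eq_left h, mul_one]
    calc _ ≤ ‖Complex.exp (x * Complex.I)‖ + ‖(1 + x * Complex.I - x ^ 2 / 2 : ℂ)‖ := norm_sub_le _ _
      _ ≤ 1 + ((1 + |x|) + x ^ 2 / 2) := by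
        refine add_le_add (Complex.norm_exp_ofReal_mul_I x).le
          ((norm_sub_le _ _).trans (add_le_add ((norm_add_le _ _).trans ?_) ?_))
        · simp
        · simp
      _ ≤ 4 * x ^ 2 := by
        have : 1 ≤ |x| ^ 2 := one_le_pow₀ h
        have h2 : |x| ≤ |x| ^ 2 := by nlinarith
        rw [sq_abs] at this h2
        linarith

lemma abs_exp_neg_sub_le_sq {x : ℝ} (hx : 0 ≤ x) : |Real.exp (-x) - (1 - x)| ≤ x ^ 2 := by
  rcases le_total x 1 with h | h
  · have := Real.abs_exp_sub_one_sub_id_le (x := -x) (by rwa [abs_neg, abs_of_nonneg hx])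
    rw [neg_sq] at this
    convert this using 2
    ring
  · have h1 := Real.add_one_le_exp (-x)
    have h2 : Real.exp (-x) ≤ 1 := Real.exp_le_one_iff.2 (by linarith)
    rw [abs_of_nonneg (by linarith)]
    nlinarith

lemma norm_pow_sub_pow_le_mul {a b : ℂ} (ha : ‖a‖ ≤ 1) (hb : ‖b‖ ≤ 1) (n : ℕ) :
    ‖a ^ n - b ^ n‖ ≤ n * ‖a - b‖ := by
  induction n with
  | zero => simp
  | succ n ih =>
    have : a ^ (n + 1) - b ^ (n + 1) = a ^ n * (a - b) + (a ^ n - b ^ n) * b := by ring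
    rw [this]
    calc _ ≤ ‖a ^ n‖ * ‖a - b‖ + ‖a ^ n - b ^ n‖ * ‖b‖ := by
          refine (norm_add_le _ _).trans (by simp)
      _ ≤ 1 * ‖a - b‖ + (n * ‖a - b‖) * 1 := by
        gcongr
        rw [norm_pow]
        exact pow_le_one₀ (norm_nonneg _) ha
      _ = _ := by push_cast; ring

lemma integrable_sq_mul_min {α : Type*} [MeasurableSpace α] {ν : Measure α} {X : α → ℝ} (hX : MemLp X 2 ν) :
    Integrable (fun a => X a ^ 2 * min 1 |X a|) ν := by
  have hm := hX.1
  refine hX.integrable_sq.mono' (by fun_prop) (ae_of_all _ fun a => ?_)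
  rw [Real.norm_of_nonneg (by positivity)]
  exact mul_le_of_le_one_right (sq_nonneg _) (min_le_left _ _)

section

variable {α : Type*} [MeasurableSpace α] {ν : Measure α} [IsProbabilityMeasure ν]

/-- Integrate the pointwise Taylor bound; centring removes the linear term. The truncated error x²
min(1, |x|) needs only a second moment, where a cubic error would need a third. -/
lemma norm_charFun_sub_le {X : α → ℝ} (hX : MemLp X 2 ν) (h0 : ∫ a, X a ∂ν = 0) (c : ℝ) :
    ‖charFun (ν.map X) c - (1 - c ^ 2 * (∫ a, X a ^ 2 ∂ν) / 2 : ℝ)‖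
      ≤ 4 * ∫ a, (c * X a) ^ 2 * min 1 |c * X a| ∂ν := by
  have hcX : MemLp (fun a => c * X a) 2 ν := hX.const_mul c
  have h1 : charFun (ν.map X) c = ∫ a, Complex.exp ((c * X a : ℝ) * Complex.I) ∂ν := by
    rw [charFun_apply_real, integral_map hX.1.aemeasurable (by fun_prop)]
    simp
  have hi1 : Integrable (fun a => ((c * X a : ℝ) : ℂ) * Complex.I) ν :=
    (hcX.integrable (by norm_num)).ofReal.mul_const _
  have hi2 : Integrable (fun a => (((c * X a : ℝ) : ℂ)) ^ 2 / 2) ν := by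
    have := (hcX.integrable_sq.ofReal (𝕜 := ℂ)).div_const 2
    simpa using this
  have hie : Integrable (fun a => Complex.exp ((c * X a : ℝ) * Complex.I)) ν := by
    have hm := hcX.1
    refine Integrable.of_bound (C := 1)
      (Complex.continuous_exp.comp_aestronglyMeasurable hi1.1) (ae_of_all _ fun a => ?_)
    exact (Complex.norm_exp_ofReal_mul_I _).le
  have hz : ∫ a, ((c * X a : ℝ) : ℂ) ∂ν = 0 := by
    rw [integral_complex_ofReal, integral_const_mul, h0, mul_zero, Complex.ofReal_zero]
  have h2 : ((1 - c ^ 2 * (∫ a, X a ^ 2 ∂ν) / 2 : ℝ) : ℂ)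
      = ∫ a, (1 + ((c * X a : ℝ) : ℂ) * Complex.I - ((c * X a : ℝ) : ℂ) ^ 2 / 2) ∂ν := by
    rw [integral_sub (by exact (integrable_const _).add hi1) hi2,
      integral_add (integrable_const _) hi1, integral_mul_const, hz, integral_div]
    have : ∫ a, ((c * X a : ℝ) : ℂ) ^ 2 ∂ν = ((c ^ 2 * ∫ a, X a ^ 2 ∂ν : ℝ) : ℂ) := by
      rw [← integral_const_mul, ← integral_complex_ofReal]
      refine integral_congr_ae (ae_of_all _ fun a => ?_)
      push_cast
      ring
    rw [this]
    simp
  rw [h1, h2, ← integral_sub hie (by exact ((integrable_const _).add hi1).sub hi2),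
    ← integral_const_mul]
  refine norm_integral_le_of_norm_le ((integrable_sq_mul_min hcX).const_mul 4)
    (ae_of_all _ fun a => norm_exp_mul_I_sub_taylor_two_le _)

/-- The Gaussian factor is itself an n-th power, so telescoping in the unit disc reduces the claim
to one factor, where both sides are compared with 1 − c²v/2. -/
lemma norm_charFun_pow_sub_exp_le {X : α → ℝ} (hX : MemLp X 2 ν) (h0 : ∫ a, X a ∂ν = 0) (c : ℝ)
    (n : ℕ) :
    ‖charFun (ν.map X) c ^ n - (Real.exp (-(n * c ^ 2 * (∫ a, X a ^ 2 ∂ν) / 2)) : ℝ)‖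
      ≤ n * (4 * (∫ a, (c * X a) ^ 2 * min 1 |c * X a| ∂ν)
        + (c ^ 2 * (∫ a, X a ^ 2 ∂ν) / 2) ^ 2) := by
  set v := ∫ a, X a ^ 2 ∂ν with hv
  have hv0 : 0 ≤ v := integral_nonneg fun a => sq_nonneg _
  have hx : 0 ≤ c ^ 2 * v / 2 := by positivity
  have := Measure.isProbabilityMeasure_map hX.1.aemeasurable (μ := ν)
  have h1 : ((Real.exp (-(n * c ^ 2 * v / 2)) : ℝ) : ℂ)
      = ((Real.exp (-(c ^ 2 * v / 2)) : ℝ) : ℂ) ^ n := by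
    rw [← Complex.ofReal_pow, ← Real.exp_nat_mul]
    congr 2
    ring
  rw [h1]
  refine (norm_pow_sub_pow_le_mul (norm_charFun_le_one _) ?_ n).trans ?_
  · rw [Complex.norm_real, Real.norm_of_nonneg (Real.exp_pos _).le]
    exact Real.exp_le_one_iff.2 (by linarith)
  · gcongr
    have h2 := norm_charFun_sub_le hX h0 c
    have h3 := abs_exp_neg_sub_le_sq hx
    rw [abs_sub_comm, ← Real.norm_eq_abs, ← Complex.norm_real] at h3
    refine (norm_sub_le_norm_sub_add_norm_sub _ ((1 - c ^ 2 * v / 2 : ℝ) : ℂ) _).trans ?_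
    refine add_le_add h2 ?_
    rwa [Complex.ofReal_sub] at h3

/-- A triangular-array central limit estimate: the `N n`-th power of the characteristic function
of a dominated, centred sequence is asymptotically Gaussian. -/
lemma tendsto_charFun_pow_sub_exp {X : ℕ → α → ℝ} {G : α → ℝ} (hX : ∀ n, Measurable (X n))
    (hG : MemLp G 2 ν) (hXG : ∀ n a, |X n a| ≤ G a) (h0 : ∀ n, ∫ a, X n a ∂ν = 0)
    {c : ℕ → ℝ} {N : ℕ → ℕ} {K : ℝ} (hc : Tendsto c atTop (𝓝 0)) (hK : ∀ n, N n * c n ^ 2 ≤ K)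
    (t : ℝ) :
    Tendsto (fun n => charFun (ν.map (X n)) (c n * t) ^ N n
      - (Real.exp (-(N n * (c n * t) ^ 2 * (∫ a, X n a ^ 2 ∂ν) / 2)) : ℝ)) atTop (𝓝 0) := by
  have hXL : ∀ n, MemLp (X n) 2 ν := fun n =>
    hG.mono (hX n).aestronglyMeasurable (ae_of_all _ fun a => by
      rw [Real.norm_eq_abs, Real.norm_eq_abs]; exact (hXG n a).trans (le_abs_self _))
  set V := ∫ a, G a ^ 2 ∂ν
  have hsq : ∀ n a, X n a ^ 2 ≤ G a ^ 2 := fun n a =>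
    sq_le_sq.2 ((hXG n a).trans (le_abs_self _))
  have hv0 : ∀ n, 0 ≤ ∫ a, X n a ^ 2 ∂ν := fun n => integral_nonneg fun a => sq_nonneg _
  have hvV : ∀ n, ∫ a, X n a ^ 2 ∂ν ≤ V := fun n =>
    integral_mono (hXL n).integrable_sq hG.integrable_sq (hsq n)
  have hK0 : 0 ≤ K := le_trans (by positivity) (hK 0)
  -- This is the Lindeberg condition: it depends on the array only through the common envelope `G`
  -- and the scale `c n → 0`. The number `N n` of summands need not tend to infinity.
  have hdom : Tendsto (fun n => ∫ a, G a ^ 2 * min 1 (|c n * t| * |G a|) ∂ν) atTop (𝓝 0) := by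
    have hm := hG.1
    have := tendsto_integral_of_dominated_convergence (μ := ν) (fun a => G a ^ 2)
      (F := fun n a => G a ^ 2 * min 1 (|c n * t| * |G a|)) (f := fun _ => 0)
      (fun n => by fun_prop) hG.integrable_sq (fun n => ae_of_all _ fun a => ?_)
      (ae_of_all _ fun a => ?_)
    · simpa using this
    · rw [Real.norm_of_nonneg (by positivity)]
      exact mul_le_of_le_one_right (sq_nonneg _) (min_le_left _ _)
    · have h1 : Tendsto (fun n => |c n * t| * |G a|) atTop (𝓝 0) := by
        have := ((hc.mul_const t).abs).mul_const |G a|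
        simpa using this
      have h2 := (tendsto_const_nhds (x := (1 : ℝ))).min h1
      have h3 := h2.const_mul (G a ^ 2)
      simpa using h3
  refine squeeze_zero_norm (a := fun n =>
    4 * (K * t ^ 2) * (∫ a, G a ^ 2 * min 1 (|c n * t| * |G a|) ∂ν)
      + K * t ^ 4 * V ^ 2 / 4 * c n ^ 2) (fun n => ?_) ?_
  · refine (norm_charFun_pow_sub_exp_le (hXL n) (h0 n) (c n * t) (N n)).trans ?_
    rw [mul_add]
    refine add_le_add ?_ ?_
    · have h1 : ∫ a, (c n * t * X n a) ^ 2 * min 1 |c n * t * X n a| ∂ν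
          ≤ (c n * t) ^ 2 * ∫ a, G a ^ 2 * min 1 (|c n * t| * |G a|) ∂ν := by
        rw [← integral_const_mul]
        have hi : Integrable (fun a => G a ^ 2 * min 1 (|c n * t| * |G a|)) ν := by
          have hm := hG.1
          refine hG.integrable_sq.mono' (by fun_prop) (ae_of_all _ fun a => ?_)
          rw [Real.norm_of_nonneg (by positivity)]
          exact mul_le_of_le_one_right (sq_nonneg _) (min_le_left _ _)
        refine integral_mono (integrable_sq_mul_min ((hXL n).const_mul _)) (hi.const_mul _)
          fun a => ?_
        simp only
        rw [mul_pow (c n * t), mul_assoc, abs_mul (c n * t)]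
        refine mul_le_mul_of_nonneg_left ?_ (sq_nonneg _)
        refine mul_le_mul (hsq n a) ?_ (by positivity) (sq_nonneg _)
        gcongr _ ⊓ (_ * ?_)
        exact (hXG n a).trans (le_abs_self _)
      have hI0 : 0 ≤ ∫ a, G a ^ 2 * min 1 (|c n * t| * |G a|) ∂ν :=
        integral_nonneg fun a => by positivity
      calc _ ≤ (N n : ℝ) * (4 * ((c n * t) ^ 2 * ∫ a, G a ^ 2 * min 1 (|c n * t| * |G a|) ∂ν)) := by
            gcongr
        _ = 4 * ((N n * c n ^ 2) * t ^ 2) * ∫ a, G a ^ 2 * min 1 (|c n * t| * |G a|) ∂ν := by ring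
        _ ≤ _ := by
          gcongr
          exact hK n
    · calc _ = (N n * c n ^ 2) * t ^ 4 * (∫ a, X n a ^ 2 ∂ν) ^ 2 / 4 * c n ^ 2 := by ring
        _ ≤ _ := by
          gcongr
          · exact hK n
          · exact hvV n
  · have h2 := (hdom.const_mul (4 * (K * t ^ 2))).add ((hc.pow 2).const_mul (K * t ^ 4 * V ^ 2 / 4))
    simpa using h2

end

/-! ### Perturbation by an `L²`-negligible remainder -/

lemma norm_exp_mul_I_sub_exp_mul_I_le (x y : ℝ) :
    ‖Complex.exp (x * Complex.I) - Complex.exp (y * Complex.I)‖ ≤ |x - y| := by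
  have h : Complex.exp (x * Complex.I) - Complex.exp (y * Complex.I)
      = Complex.exp (y * Complex.I) * (Complex.exp (Complex.I * (x - y : ℝ)) - 1) := by
    rw [mul_sub, ← Complex.exp_add, mul_one]
    congr 2
    push_cast
    ring
  rw [h, norm_mul, Complex.norm_exp_ofReal_mul_I, one_mul]
  exact Real.norm_exp_I_mul_ofReal_sub_one_le

/-- If `M n` is square integrable with second moment `1` and its characteristic function converges
to the standard Gaussian one, then adding an `L²`-negligible remainder preserves both the
asymptotic normality and the convergence of the second moment. -/
theorem clt_and_second_moment_of_negligible {Ω : ℕ → Type*} [∀ n, MeasurableSpace (Ω n)]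
    (μ : ∀ n, Measure (Ω n)) [∀ n, IsProbabilityMeasure (μ n)] {M R : ∀ n, Ω n → ℝ}
    (hM : ∀ n, Measurable (M n)) (hR : ∀ n, Measurable (R n))
    (hM2 : ∀ᶠ n in atTop, MemLp (M n) 2 (μ n)) (hM1 : ∀ᶠ n in atTop, ∫ ω, M n ω ^ 2 ∂(μ n) = 1)
    (hR0 : Tendsto (fun n => ∫⁻ ω, ENNReal.ofReal (R n ω ^ 2) ∂(μ n)) atTop (𝓝 0))
    (hchar : ∀ t : ℝ, Tendsto (fun n => charFun ((μ n).map (M n)) t) atTop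
      (𝓝 (Complex.exp (-t ^ 2 / 2)))) :
    TendstoInDistribution (fun n ω => M n ω + R n ω) atTop (id : ℝ → ℝ) μ (gaussianReal 0 1)
    ∧ Tendsto (fun n => ∫ ω, (M n ω + R n ω) ^ 2 ∂(μ n)) atTop (𝓝 1) := by
  have hRfin : ∀ᶠ n in atTop, MemLp (R n) 2 (μ n) := by
    filter_upwards [hR0.eventually (gt_mem_nhds (show (0 : ENNReal) < 1 by simp))] with n hn
    rw [memLp_two_iff_integrable_sq (hR n).aestronglyMeasurable]
    refine ⟨by have := hR n; fun_prop, ?_⟩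
    rw [hasFiniteIntegral_iff_ofReal (ae_of_all _ fun ω => sq_nonneg _)]
    exact hn.trans (by simp)
  have hRI : Tendsto (fun n => ∫ ω, R n ω ^ 2 ∂(μ n)) atTop (𝓝 0) := by
    have h := (ENNReal.tendsto_toReal (a := 0) (by simp)).comp hR0
    refine Tendsto.congr (fun n => ?_) h
    rw [integral_eq_lintegral_of_nonneg_ae (ae_of_all _ fun ω => sq_nonneg _)
      (by have := hR n; fun_prop)]
    rfl
  -- Cauchy–Schwarz, with the normalisation E M² = 1; this kills the cross term in the second
  -- moment.
  have hMR : ∀ᶠ n in atTop, |∫ ω, M n ω * R n ω ∂(μ n)| ≤ Real.sqrt (∫ ω, R n ω ^ 2 ∂(μ n)) := by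
    filter_upwards [hM2, hM1, hRfin] with n h1 h2 h3
    have := integral_mul_norm_le_Lp_mul_Lq (μ := μ n) (f := M n) (g := R n) (p := 2) (q := 2)
      (by constructor <;> norm_num) (by simpa using h1) (by simpa using h3)
    simp only [Real.norm_eq_abs, Real.rpow_ofNat, sq_abs, h2, Real.one_rpow, one_mul] at this
    rw [Real.sqrt_eq_rpow]
    refine le_trans ?_ this
    refine (abs_integral_le_integral_abs).trans (le_of_eq ?_)
    simp [abs_mul]
  have hsqrt : Tendsto (fun n => Real.sqrt (∫ ω, R n ω ^ 2 ∂(μ n))) atTop (𝓝 0) := by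
    simpa using hRI.sqrt
  constructor
  · refine ⟨fun n => ((hM n).add (hR n)).aemeasurable, aemeasurable_id, ?_⟩
    refine ProbabilityMeasure.tendsto_iff_tendsto_charFun.2 fun t => ?_
    have hgoal : Tendsto (fun n => charFun ((μ n).map (fun ω => M n ω + R n ω)) t) atTop
        (𝓝 (Complex.exp (-t ^ 2 / 2))) := by
      have hd : Tendsto (fun n => charFun ((μ n).map (fun ω => M n ω + R n ω)) t
          - charFun ((μ n).map (M n)) t) atTop (𝓝 0) := by
        have hs := hsqrt.const_mul |t|
        rw [mul_zero] at hs
        refine squeeze_zero_norm' ?_ hs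
        filter_upwards [hRfin] with n h3
        have hmM := hM n
        have hmR := hR n
        rw [charFun_apply_real, charFun_apply_real, integral_map (by fun_prop) (by fun_prop),
          integral_map (by fun_prop) (by fun_prop)]
        have hint : ∀ {f : Ω n → ℝ}, Measurable f →
            Integrable (fun ω => Complex.exp ((t * f ω : ℝ) * Complex.I)) (μ n) := by
          intro f hf
          refine Integrable.of_bound (C := 1) (by fun_prop) (ae_of_all _ fun a => ?_)
          exact (Complex.norm_exp_ofReal_mul_I _).le
        have e1 := hint (hmM.add hmR)
        have e2 := hint hmM
        simp only [Complex.ofReal_mul, Pi.add_apply] at e1 e2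
        rw [← integral_sub e1 e2]
        have hRi : Integrable (fun ω => |R n ω|) (μ n) := (h3.integrable (by norm_num)).abs
        calc _ ≤ ∫ ω, |t| * |R n ω| ∂(μ n) := by
              refine norm_integral_le_of_norm_le (hRi.const_mul _) (ae_of_all _ fun ω => ?_)
              have := norm_exp_mul_I_sub_exp_mul_I_le (t * (M n ω + R n ω)) (t * M n ω)
              push_cast at this ⊢
              refine this.trans (le_of_eq ?_)
              rw [← abs_mul]
              congr 1
              ring
          _ = |t| * ∫ ω, |R n ω| ∂(μ n) := integral_const_mul _ _
          _ ≤ _ := by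
            gcongr
            -- (E|R|)² ≤ E R² is the non-negativity of the variance of |R|.
            apply Real.le_sqrt_of_sq_le
            have hv := variance_nonneg (fun ω => |R n ω|) (μ n)
            rw [variance_eq_sub (show MemLp (fun ω => |R n ω|) 2 (μ n) from h3.abs)] at hv
            simpa using hv
      have := hd.add (hchar t)
      simpa using this
    have h0 : charFun (gaussianReal 0 1) t = Complex.exp (-t ^ 2 / 2) := by
      rw [charFun_gaussianReal]
      congr 1
      simp
      ring
    simpa [h0] using hgoal
  · have hlim : Tendsto (fun n => 1 + 2 * (∫ ω, M n ω * R n ω ∂(μ n)) + ∫ ω, R n ω ^ 2 ∂(μ n)) atTop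
        (𝓝 (1 + 2 * 0 + 0)) := by
      refine (tendsto_const_nhds.add (Tendsto.const_mul 2 ?_)).add hRI
      refine squeeze_zero_norm' ?_ hsqrt
      filter_upwards [hMR] with n h
      simpa using h
    rw [mul_zero, add_zero, add_zero] at hlim
    refine hlim.congr' ?_
    filter_upwards [hM2, hM1, hRfin] with n h1 h2 h3
    have e : ∀ ω, (M n ω + R n ω) ^ 2 = M n ω ^ 2 + 2 * (M n ω * R n ω) + R n ω ^ 2 :=
      fun ω => by ring
    simp_rw [e]
    have i2 : Integrable (fun ω => 2 * (M n ω * R n ω)) (μ n) := (h1.integrable_mul h3).const_mul 2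
    rw [integral_add (by exact h1.integrable_sq.add i2) h3.integrable_sq,
      integral_add h1.integrable_sq i2, integral_const_mul, h2]

/-! ### Measure-preserving rearrangements of product measures -/

section Product

variable {𝒴 : Type*} [MeasurableSpace 𝒴] {Q : Measure 𝒴} [IsProbabilityMeasure Q]

lemma measurePreserving_comp_injective {ι κ : Type*} [Fintype ι] [Fintype κ] {e : ι → κ}
    (he : Function.Injective e) :
    MeasurePreserving (fun (y : κ → 𝒴) i => y (e i)) (Measure.pi fun _ => Q)
      (Measure.pi fun _ => Q) := by
  refine ⟨by fun_prop, ?_⟩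
  have h : iIndepFun (fun (i : κ) (y : κ → 𝒴) => y i) (Measure.pi fun _ => Q) :=
    iIndepFun_pi (X := fun _ => id) (fun _ => aemeasurable_id)
  have h2 := h.precomp he
  rw [iIndepFun_iff_map_fun_eq_pi_map (fun i => (measurable_pi_apply _).aemeasurable)] at h2
  refine h2.trans ?_
  congr 1
  funext i
  exact (measurePreserving_eval (fun _ : κ => Q) (e i)).map_eq

/-- Resampling the coordinates satisfying `p` preserves a product measure. -/
lemma measurePreserving_resample {κ : Type*} [Fintype κ] (p : κ → Prop) [DecidablePred p] :
    MeasurePreserving (fun (z : (κ → 𝒴) × (κ → 𝒴)) i => if p i then z.2 i else z.1 i)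
      ((Measure.pi fun _ => Q).prod (Measure.pi fun _ => Q)) (Measure.pi fun _ => Q) := by
  have hm : Measurable (fun (z : (κ → 𝒴) × (κ → 𝒴)) i => if p i then z.2 i else z.1 i) := by
    refine measurable_pi_lambda _ fun i => ?_
    split_ifs <;> fun_prop
  refine ⟨hm, (Measure.pi_eq fun s hs => ?_).symm⟩
  rw [Measure.map_apply hm (MeasurableSet.univ_pi hs)]
  have : (fun (z : (κ → 𝒴) × (κ → 𝒴)) i => if p i then z.2 i else z.1 i) ⁻¹' Set.univ.pi s
      = (Set.univ.pi fun i => if p i then Set.univ else s i)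
        ×ˢ (Set.univ.pi fun i => if p i then s i else Set.univ) := by
    ext z
    simp only [Set.mem_preimage, Set.mem_univ_pi, Set.mem_prod, ← forall_and]
    refine forall_congr' fun i => ?_
    by_cases h : p i <;> simp [h]
  rw [this, Measure.prod_prod, Measure.pi_pi, Measure.pi_pi, ← Finset.prod_mul_distrib]
  refine Finset.prod_congr rfl fun i _ => ?_
  by_cases h : p i <;> simp [h]

/-- The overwritten coordinate is simply discarded, so an independent copy may take its place.
Through Fubini this makes integration of `Function.update v k y` over `v` a version of conditioning
on coordinate `k`. -/
lemma measurePreserving_update {ι : Type*} [Fintype ι] [DecidableEq ι] (k : ι) :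
    MeasurePreserving (fun z : 𝒴 × (ι → 𝒴) => Function.update z.2 k z.1)
      (Q.prod (Measure.pi fun _ => Q)) (Measure.pi fun _ => Q) := by
  have hm : Measurable (fun z : 𝒴 × (ι → 𝒴) => Function.update z.2 k z.1) := by
    refine measurable_pi_lambda _ fun i => ?_
    by_cases h : i = k
    · subst h; simpa using measurable_fst
    · simp only [Function.update_of_ne h]; fun_prop
  refine ⟨hm, (Measure.pi_eq fun s hs => ?_).symm⟩
  rw [Measure.map_apply hm (MeasurableSet.univ_pi hs)]
  have : (fun z : 𝒴 × (ι → 𝒴) => Function.update z.2 k z.1) ⁻¹' Set.univ.pi s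
      = s k ×ˢ (Set.univ.pi (Function.update s k Set.univ)) := by
    ext z
    simp only [Set.mem_preimage, Set.mem_univ_pi, Set.mem_prod]
    constructor
    · intro h
      refine ⟨by simpa using h k, fun i => ?_⟩
      by_cases hi : i = k
      · subst hi; simp
      · simpa [Function.update_of_ne hi] using h i
    · rintro ⟨h1, h2⟩ i
      by_cases hi : i = k
      · subst hi; simpa using h1
      · simpa [Function.update_of_ne hi] using h2 i
  rw [this, Measure.prod_prod, Measure.pi_pi, ← Finset.mul_prod_erase _ _ (Finset.mem_univ k),
    ← Finset.mul_prod_erase _ (fun i => Q (s i)) (Finset.mem_univ k)]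
  rw [Function.update_self, measure_univ, one_mul]
  congr 1
  refine Finset.prod_congr rfl fun i hi => ?_
  rw [Function.update_of_ne (Finset.ne_of_mem_erase hi)]

end Product

/-! ### Counting embeddings -/

section Counting

lemma exists_perm_apply_eq_and {κ : Type*} [DecidableEq κ] {i j i' j' : κ} (h : i ≠ j) (h' : i' ≠ j') :
    ∃ σ : Equiv.Perm κ, σ i = i' ∧ σ j = j' := by
  have hx : i' ≠ Equiv.swap i i' j := by
    intro hc
    have := congrArg (Equiv.swap i i') hc
    simp at this
    exact h this
  refine ⟨(Equiv.swap i i').trans (Equiv.swap (Equiv.swap i i' j) j'), ?_, ?_⟩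
  · simp [Equiv.swap_apply_of_ne_of_ne hx h']
  · simp

variable {ι κ : Type*} [Fintype ι] [Fintype κ] [DecidableEq κ]

/-- Swapping two values in `κ` carries one fibre of `e ↦ e k` bijectively to another, so all fibres
have the same size. -/
lemma card_filter_apply_eq_mul_card (k : ι) (i : κ) :
    (Finset.univ.filter fun e : ι ↪ κ => e k = i).card * Fintype.card κ = Fintype.card (ι ↪ κ) := by
  have h1 : ∀ j : κ, (Finset.univ.filter fun e : ι ↪ κ => e k = j).card
      = (Finset.univ.filter fun e : ι ↪ κ => e k = i).card := by
    intro j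
    refine Finset.card_bij' (fun e _ => e.trans (Equiv.swap j i).toEmbedding)
      (fun e _ => e.trans (Equiv.swap j i).toEmbedding) ?_ ?_ ?_ ?_
    · intro e he
      simp only [Finset.mem_filter, Finset.mem_univ, true_and] at he ⊢
      simp [he]
    · intro e he
      simp only [Finset.mem_filter, Finset.mem_univ, true_and] at he ⊢
      simp [he]
    · intro e _; ext x; simp
    · intro e _; ext x; simp
  have h2 := Finset.card_eq_sum_card_fiberwise (s := (Finset.univ : Finset (ι ↪ κ)))
    (t := (Finset.univ : Finset κ)) (f := fun e => e k) (fun _ _ => by simp)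
  rw [Finset.sum_congr rfl (fun j _ => h1 j)] at h2
  simp only [Finset.sum_const, smul_eq_mul, Finset.card_univ] at h2
  rw [h2, mul_comm]

/-- Permutations act transitively on ordered pairs of distinct points, so the fibres of `e ↦ (e k, e
l)` over the off-diagonal are equinumerous. -/
lemma card_filter_apply_eq_and_mul_card {k l : ι} (hkl : k ≠ l) {i j : κ} (hij : i ≠ j) :
    (Finset.univ.filter fun e : ι ↪ κ => e k = i ∧ e l = j).card
      * (Fintype.card κ * (Fintype.card κ - 1)) = Fintype.card (ι ↪ κ) := by
  have h1 : ∀ p ∈ (Finset.univ : Finset κ).offDiag,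
      (Finset.univ.filter fun e : ι ↪ κ => (e k, e l) = p).card
      = (Finset.univ.filter fun e : ι ↪ κ => e k = i ∧ e l = j).card := by
    rintro ⟨a, b⟩ hp
    simp only [Finset.mem_offDiag, Finset.mem_univ, true_and] at hp
    obtain ⟨σ, h1, h2⟩ := exists_perm_apply_eq_and hp hij
    refine Finset.card_bij' (fun e _ => e.trans σ.toEmbedding)
      (fun e _ => e.trans σ.symm.toEmbedding) ?_ ?_ ?_ ?_
    · intro e he
      simp only [Finset.mem_filter, Finset.mem_univ, true_and, Prod.mk.injEq] at he ⊢
      simp [he, h1, h2]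
    · intro e he
      simp only [Finset.mem_filter, Finset.mem_univ, true_and, Prod.mk.injEq] at he ⊢
      simp [he, ← h1, ← h2]
    · intro e _; ext x; simp
    · intro e _; ext x; simp
  have h2 := Finset.card_eq_sum_card_fiberwise (s := (Finset.univ : Finset (ι ↪ κ)))
    (t := (Finset.univ : Finset κ).offDiag) (f := fun e => (e k, e l))
    (fun e _ => by simpa using fun hc => hkl (e.injective hc))
  rw [Finset.sum_congr rfl h1] at h2
  simp only [Finset.sum_const, smul_eq_mul, Finset.card_univ, Finset.offDiag_card] at h2
  rw [h2, Nat.mul_sub_one, mul_comm]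

lemma sum_embedding_apply [Nonempty κ] (k : ι) (h : κ → ℝ) :
    ∑ e : ι ↪ κ, h (e k)
      = (Fintype.card (ι ↪ κ) : ℝ) / Fintype.card κ * ∑ i, h i := by
  rw [← Finset.sum_fiberwise (s := Finset.univ) (g := fun e : ι ↪ κ => e k), Finset.mul_sum]
  refine Finset.sum_congr rfl fun i _ => ?_
  rw [Finset.sum_congr rfl (g := fun _ => h i) (fun e he => by rw [(Finset.mem_filter.1 he).2]),
    Finset.sum_const, nsmul_eq_mul]
  have hc : (Fintype.card κ : ℝ) ≠ 0 := by exact_mod_cast Fintype.card_ne_zero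
  rw [← card_filter_apply_eq_mul_card k i, Nat.cast_mul, mul_div_cancel_right₀ _ hc]

end Counting

/-! ### Completely degenerate U-statistics -/

section Degenerate

variable {𝒴 : Type*} [MeasurableSpace 𝒴] {Q : Measure 𝒴} [IsProbabilityMeasure Q]
  {ι κ : Type*} [Fintype ι] [Fintype κ] {g : (ι → 𝒴) → ℝ}

lemma memLp_comp_injective (hg : MemLp g 2 (Measure.pi fun _ => Q)) {e : ι → κ}
    (he : Function.Injective e) :
    MemLp (fun y : κ → 𝒴 => g fun i => y (e i)) 2 (Measure.pi fun _ => Q) :=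
  hg.comp_measurePreserving (measurePreserving_comp_injective he)

/-- The dichotomy behind the variance bound: at most one shared index gives an orthogonal pair, two
shared indices give a rare one. -/
lemma exists_forall_ne_notMem_or {ι κ : Type*} [Nonempty ι] (e e' : ι ↪ κ) :
    (∃ k, ∀ j, j ≠ k → e' j ∉ Set.range e)
      ∨ ∃ k l a b, k ≠ l ∧ a ≠ b ∧ e' k = e a ∧ e' l = e b := by
  by_cases h : ∃ k, e' k ∈ Set.range e
  · obtain ⟨k, a, ha⟩ := h
    by_cases h2 : ∃ l, l ≠ k ∧ e' l ∈ Set.range e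
    · obtain ⟨l, hl, b, hb⟩ := h2
      refine Or.inr ⟨k, l, a, b, hl.symm, ?_, ha.symm, hb.symm⟩
      rintro rfl
      exact hl (e'.injective (hb.symm.trans ha))
    · push Not at h2
      exact Or.inl ⟨k, h2⟩
  · push Not at h
    exact Or.inl ⟨Classical.arbitrary ι, fun j _ => h j⟩

variable [DecidableEq ι]

/-- Redraw all coordinates used by `e'` except `e' k`. The first factor does not see them, and
averaging the second over them, with coordinate `e' k` frozen, gives zero by degeneracy. The point
`e' k` itself may or may not be used by `e`. -/
lemma integral_mul_eq_zero_of_degenerate (hgm : Measurable g)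
    (hg : MemLp g 2 (Measure.pi fun _ => Q))
    (hdeg : ∀ k, ∀ᵐ y ∂Q, ∫ v, g (Function.update v k y) ∂(Measure.pi fun _ => Q) = 0)
    (e e' : ι ↪ κ) (k : ι) (hk : ∀ j, j ≠ k → e' j ∉ Set.range e) :
    ∫ y : κ → 𝒴, (g fun i => y (e i)) * (g fun i => y (e' i)) ∂(Measure.pi fun _ => Q) = 0 := by
  classical
  let p : κ → Prop := fun i => ∃ j, j ≠ k ∧ e' j = i
  have hp := measurePreserving_resample (Q := Q) p
  have hint : Integrable (fun y : κ → 𝒴 => (g fun i => y (e i)) * (g fun i => y (e' i)))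
      (Measure.pi fun _ => Q) :=
    (memLp_comp_injective hg e.injective).integrable_mul (memLp_comp_injective hg e'.injective)
  rw [← hp.map_eq, integral_map hp.measurable.aemeasurable (by rw [hp.map_eq]; exact hint.1)]
  have hprod := integral_prod _ (hp.integrable_comp_of_integrable hint)
  simp only [Function.comp_def] at hprod
  rw [hprod]
  refine integral_eq_zero_of_ae ?_
  have hae := (measurePreserving_eval (fun _ : κ => Q) (e' k)).quasiMeasurePreserving.ae (hdeg k)
  filter_upwards [hae] with y hy
  have hpe : ∀ i, ¬ p (e i) := by
    rintro i ⟨j, hj, hji⟩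
    exact hk j hj ⟨i, hji.symm⟩
  have h2 : ∀ y' : κ → 𝒴, (fun i => if p (e' i) then y' (e' i) else y (e' i))
      = Function.update (fun i => y' (e' i)) k (y (e' k)) := by
    intro y'
    funext i
    by_cases hi : i = k
    · subst hi
      have : ¬ p (e' i) := by
        rintro ⟨j, hj, hji⟩
        exact hj (e'.injective hji)
      simp [this]
    · have : p (e' i) := ⟨i, hi, rfl⟩
      simp [this, hi]
  simp only [hpe, if_false, h2, Pi.zero_apply]
  rw [integral_const_mul]
  have hmp := measurePreserving_comp_injective (𝒴 := 𝒴) (Q := Q) e'.injective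
  have hmu : Measurable fun v : ι → 𝒴 => g (Function.update v k (y (e' k))) := by
    refine hgm.comp (measurable_pi_lambda _ fun i => ?_)
    by_cases h : i = k
    · subst h; simp
    · simp only [Function.update_of_ne h]; fun_prop
  have h3 := integral_map (μ := Measure.pi fun _ : κ => Q) hmp.measurable.aemeasurable (f := fun v : ι → 𝒴 =>
    g (Function.update v k (y (e' k)))) hmu.aestronglyMeasurable
  rw [hmp.map_eq] at h3
  rw [← h3, hy, mul_zero]

variable [DecidableEq κ]

lemma integral_sq_sum_le_of_degenerate [Nonempty ι] (hgm : Measurable g)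
    (hg : MemLp g 2 (Measure.pi fun _ => Q))
    (hdeg : ∀ k, ∀ᵐ y ∂Q, ∫ v, g (Function.update v k y) ∂(Measure.pi fun _ => Q) = 0)
    (hκ : 2 ≤ Fintype.card κ) :
    ∫ y : κ → 𝒴, (∑ e : ι ↪ κ, g fun i => y (e i)) ^ 2 ∂(Measure.pi fun _ => Q)
      ≤ (Fintype.card (ι ↪ κ) : ℝ) ^ 2 * (Fintype.card ι : ℝ) ^ 4
        / (Fintype.card κ * (Fintype.card κ - 1)) * ∫ v, g v ^ 2 ∂(Measure.pi fun _ => Q) := by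
  classical
  set V := ∫ v, g v ^ 2 ∂(Measure.pi fun _ : ι => Q) with hV
  have hV0 : 0 ≤ V := integral_nonneg fun _ => sq_nonneg _
  set D : ℝ := (Fintype.card (ι ↪ κ) : ℝ)
  set C : ℝ := Fintype.card κ * (Fintype.card κ - 1)
  have hc2 : (2 : ℝ) ≤ Fintype.card κ := by exact_mod_cast hκ
  have hC : 0 < C := mul_pos (by linarith) (by linarith)
  have hL : ∀ e : ι ↪ κ, MemLp (fun y : κ → 𝒴 => g fun i => y (e i)) 2 (Measure.pi fun _ => Q) :=
    fun e => memLp_comp_injective hg e.injective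
  have hsq : ∀ e : ι ↪ κ, ∫ y : κ → 𝒴, (g fun i => y (e i)) ^ 2 ∂(Measure.pi fun _ => Q) = V := by
    intro e
    have hmp := measurePreserving_comp_injective (𝒴 := 𝒴) (Q := Q) e.injective
    have h3 := integral_map (μ := Measure.pi fun _ : κ => Q) hmp.measurable.aemeasurable (f := fun v : ι → 𝒴 => g v ^ 2)
      (by fun_prop)
    rw [hmp.map_eq] at h3
    exact h3.symm
  have hI : ∀ e e' : ι ↪ κ, Integrable
      (fun y : κ → 𝒴 => (g fun i => y (e i)) * (g fun i => y (e' i))) (Measure.pi fun _ => Q) :=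
    fun e e' => (hL e).integrable_mul (hL e')
  -- `B` records one way, q = ((k, l), (a, b)), for the tuples to share two indices. A union bound
  -- over the at most (card ι)⁴ patterns replaces an exact count of overlaps.
  let B : (ι ↪ κ) → (ι ↪ κ) → (ι × ι) × (ι × ι) → ℝ := fun e e' q =>
    if q.1.1 ≠ q.1.2 ∧ q.2.1 ≠ q.2.2 ∧ e' q.1.1 = e q.2.1 ∧ e' q.1.2 = e q.2.2 then 1 else 0
  have hB0 : ∀ e e' q, 0 ≤ B e e' q := fun e e' q => by
    simp only [B]; split_ifs <;> norm_num
  have hpair : ∀ e e' : ι ↪ κ,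
      ∫ y : κ → 𝒴, (g fun i => y (e i)) * (g fun i => y (e' i)) ∂(Measure.pi fun _ => Q)
        ≤ (∑ q, B e e' q) * V := by
    intro e e'
    rcases exists_forall_ne_notMem_or e e' with ⟨k, hk⟩ | ⟨k, l, a, b, hkl, hab, h1, h2⟩
    · rw [integral_mul_eq_zero_of_degenerate hgm hg hdeg e e' k hk]
      exact mul_nonneg (Finset.sum_nonneg fun q _ => hB0 e e' q) hV0
    · have hone : 1 ≤ ∑ q, B e e' q := by
        have : B e e' ((k, l), (a, b)) = 1 := by simp [B, hkl, hab, h1, h2]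
        rw [← this]
        exact Finset.single_le_sum (fun q _ => hB0 e e' q) (Finset.mem_univ _)
      calc _ ≤ ∫ y : κ → 𝒴, ((g fun i => y (e i)) ^ 2 + (g fun i => y (e' i)) ^ 2) / 2
            ∂(Measure.pi fun _ => Q) := by
            refine integral_mono (hI e e')
              (((hL e).integrable_sq.add (hL e').integrable_sq).div_const 2) fun y => ?_
            simp only
            nlinarith [sq_nonneg ((g fun i => y (e i)) - (g fun i => y (e' i)))]
        _ = V := by
          rw [integral_div, integral_add (hL e).integrable_sq (hL e').integrable_sq, hsq, hsq]
          ring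
        _ ≤ _ := le_mul_of_one_le_left hV0 hone
  have hcount : ∀ (e : ι ↪ κ) q, ∑ e' : ι ↪ κ, B e e' q ≤ D / C := by
    rintro e ⟨⟨k, l⟩, ⟨a, b⟩⟩
    by_cases hkl : k = l
    · simp only [B, hkl, ne_eq, not_true_eq_false, false_and, if_false, Finset.sum_const_zero]
      positivity
    by_cases hab : a = b
    · simp only [B, hab, ne_eq, not_true_eq_false, false_and, and_false, if_false,
        Finset.sum_const_zero]
      positivity
    have h := card_filter_apply_eq_and_mul_card (ι := ι) (κ := κ) hkl
      (fun hc => hab (e.injective hc) : e a ≠ e b)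
    have hs : ∑ e' : ι ↪ κ, B e e' ((k, l), (a, b))
        = (Finset.univ.filter fun e' : ι ↪ κ => e' k = e a ∧ e' l = e b).card := by
      simp [B, hkl, hab]
    rw [hs, le_div_iff₀ hC]
    have h' : ((Finset.univ.filter fun e' : ι ↪ κ => e' k = e a ∧ e' l = e b).card : ℝ) * C = D := by
      simp only [C, D]
      rw [← h]
      push_cast [Nat.cast_sub (show 1 ≤ Fintype.card κ by omega)]
      ring
    exact h'.le
  have hexp : ∀ y : κ → 𝒴, (∑ e : ι ↪ κ, g fun i => y (e i)) ^ 2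
      = ∑ e : ι ↪ κ, ∑ e' : ι ↪ κ, (g fun i => y (e i)) * (g fun i => y (e' i)) := by
    intro y
    rw [sq, Finset.sum_mul_sum]
  simp_rw [hexp]
  rw [integral_finsetSum _ fun e _ => integrable_finsetSum _ fun e' _ => hI e e']
  simp_rw [integral_finsetSum _ fun e' _ => hI _ e']
  calc _ ≤ ∑ e : ι ↪ κ, ∑ e' : ι ↪ κ, (∑ q, B e e' q) * V :=
        Finset.sum_le_sum fun e _ => Finset.sum_le_sum fun e' _ => hpair e e'
    _ = (∑ e : ι ↪ κ, ∑ q, ∑ e' : ι ↪ κ, B e e' q) * V := by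
      rw [Finset.sum_mul]
      refine Finset.sum_congr rfl fun e _ => ?_
      rw [← Finset.sum_mul, Finset.sum_comm]
    _ ≤ (∑ e : ι ↪ κ, ∑ q : (ι × ι) × (ι × ι), D / C) * V := by
      gcongr with e _ q _
      exact hcount e q
    _ = _ := by
      simp only [Finset.sum_const, Finset.card_univ, Fintype.card_prod, nsmul_eq_mul]
      push_cast
      simp only [D]
      ring

end Degenerate

/-! ### Independence of regrouped random variables -/

section Independence

variable {Ω : Type*} [MeasurableSpace Ω] {μ : Measure Ω}

lemma indepFun_subtype_of_iIndepFun {ι β : Type*} [Fintype ι] [MeasurableSpace β] {V : ι → Ω → β}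
    (hV : ∀ i, Measurable (V i)) (h : iIndepFun V μ) (p q : ι → Prop) (hpq : ∀ i, p i → ¬ q i) :
    IndepFun (fun ω (i : {i // p i}) => V i ω) (fun ω (i : {i // q i}) => V i ω) μ := by
  classical
  have h1 := h.indepFun_finset (Finset.univ.filter p) (Finset.univ.filter q)
    (Finset.disjoint_filter.2 fun i _ => hpq i) hV
  exact h1.comp (φ := fun v (i : {i // p i}) => v ⟨i, by simp [i.2]⟩)
    (ψ := fun v (i : {i // q i}) => v ⟨i, by simp [i.2]⟩)
    (measurable_pi_lambda _ fun _ => measurable_pi_apply _)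
    (measurable_pi_lambda _ fun _ => measurable_pi_apply _)

variable [IsProbabilityMeasure μ]

/-- All four blocks are jointly independent, so the joint law is a fourfold product; regrouping
amounts to exchanging the two middle integrals by Tonelli. It turns a split into labeled and
unlabeled data into a split into folds. -/
lemma indepFun_prodMk_prodMk_of_indepFun {α β γ δ : Type*} [MeasurableSpace α] [MeasurableSpace β]
    [MeasurableSpace γ] [MeasurableSpace δ] {A : Ω → α} {B : Ω → β} {C : Ω → γ} {D : Ω → δ}
    (hA : Measurable A) (hB : Measurable B) (hC : Measurable C) (hD : Measurable D)
    (hAB : IndepFun A B μ) (hCD : IndepFun C D μ)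
    (h : IndepFun (fun ω => (A ω, B ω)) (fun ω => (C ω, D ω)) μ) :
    IndepFun (fun ω => (A ω, C ω)) (fun ω => (B ω, D ω)) μ := by
  have hAC : IndepFun A C μ := h.comp measurable_fst measurable_fst
  have hBD : IndepFun B D μ := h.comp measurable_snd measurable_snd
  rw [indepFun_iff_map_prod_eq_prod_map_map (by fun_prop) (by fun_prop)] at *
  rw [hAC, hBD]
  rw [hAB, hCD] at h
  have := Measure.isProbabilityMeasure_map hA.aemeasurable (μ := μ)
  have := Measure.isProbabilityMeasure_map hB.aemeasurable (μ := μ)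
  have := Measure.isProbabilityMeasure_map hC.aemeasurable (μ := μ)
  have := Measure.isProbabilityMeasure_map hD.aemeasurable (μ := μ)
  refine Measure.ext_of_lintegral _ fun f hf => ?_
  have hs : Measurable fun z : (α × β) × (γ × δ) => ((z.1.1, z.2.1), (z.1.2, z.2.2)) := by fun_prop
  have h1 : μ.map (fun ω => ((A ω, C ω), (B ω, D ω)))
      = (μ.map fun ω => ((A ω, B ω), (C ω, D ω))).map
        fun z : (α × β) × (γ × δ) => ((z.1.1, z.2.1), (z.1.2, z.2.2)) := by
    rw [Measure.map_map hs (by fun_prop)]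
    rfl
  rw [h1, h, lintegral_map hf hs, lintegral_prod _ (by fun_prop), lintegral_prod _ (by fun_prop),
    lintegral_prod _ (by fun_prop), lintegral_prod _ (by fun_prop)]
  refine lintegral_congr fun a => ?_
  have e1 : ∀ b, ∫⁻ z : γ × δ, f ((a, z.1), (b, z.2)) ∂(μ.map C).prod (μ.map D)
      = ∫⁻ c, ∫⁻ d, f ((a, c), (b, d)) ∂μ.map D ∂μ.map C := fun b =>
    lintegral_prod _ (by fun_prop)
  have e2 : ∀ c, ∫⁻ z : β × δ, f ((a, c), z) ∂(μ.map B).prod (μ.map D)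
      = ∫⁻ b, ∫⁻ d, f ((a, c), (b, d)) ∂μ.map D ∂μ.map B := fun c =>
    lintegral_prod _ (by fun_prop)
  simp_rw [e1, e2]
  refine lintegral_lintegral_swap (Measurable.aemeasurable ?_)
  have : Measurable fun z : (β × γ) × δ => f ((a, z.1.2), (z.1.1, z.2)) := by fun_prop
  exact this.lintegral_prod_right'

lemma indepFun_prodMk_right_of_indepFun {α β γ : Type*} [MeasurableSpace α] [MeasurableSpace β]
    [MeasurableSpace γ] {A : Ω → α} {B : Ω → β} {C : Ω → γ} (hA : Measurable A) (hB : Measurable B)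
    (hC : Measurable C) (hAB : IndepFun A B μ) (h : IndepFun (fun ω => (A ω, B ω)) C μ) :
    IndepFun A (fun ω => (B ω, C ω)) μ := by
  -- A trivial block next to `A` makes this a special case of the four-block regrouping.
  have h1 := indepFun_prodMk_prodMk_of_indepFun (C := fun _ => ()) hA hB measurable_const hC hAB
    (indepFun_const_left () C) (h.comp measurable_id (measurable_prodMk_left (x := ())))
  exact h1.comp measurable_fst measurable_id

end Independence

/-! ### Cross-fitted sums -/

section CrossFit

variable {Ω α 𝒳 : Type*} [MeasurableSpace Ω] [MeasurableSpace α] [MeasurableSpace 𝒳]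
  {μ : Measure Ω} {ν : Measure 𝒳}

lemma memLp_two_of_lintegral_sq_ne_top {g : 𝒳 → ℝ} (hg : Measurable g)
    (h : ∫⁻ x, ENNReal.ofReal (g x ^ 2) ∂ν ≠ ⊤) : MemLp g 2 ν := by
  rw [memLp_two_iff_integrable_sq hg.aestronglyMeasurable]
  refine ⟨by fun_prop, ?_⟩
  rw [hasFiniteIntegral_iff_ofReal (ae_of_all _ fun ω => sq_nonneg _)]
  exact h.lt_top

lemma ofReal_sq_add_add_le (x y z : ℝ) :
    ENNReal.ofReal ((x + y + z) ^ 2)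
      ≤ 3 * (ENNReal.ofReal (x ^ 2) + ENNReal.ofReal (y ^ 2) + ENNReal.ofReal (z ^ 2)) := by
  rw [← ENNReal.ofReal_add (by positivity) (by positivity),
    ← ENNReal.ofReal_add (by positivity) (by positivity),
    show (3 : ENNReal) = ENNReal.ofReal 3 by simp, ← ENNReal.ofReal_mul (by norm_num)]
  refine ENNReal.ofReal_le_ofReal ?_
  nlinarith [sq_nonneg (x - y), sq_nonneg (y - z), sq_nonneg (x - z)]

lemma lintegral_sq_add_add_le {u v w : Ω → ℝ} (hu : Measurable u) (hv : Measurable v) :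
    ∫⁻ ω, ENNReal.ofReal ((u ω + v ω + w ω) ^ 2) ∂μ
      ≤ 3 * (∫⁻ ω, ENNReal.ofReal (u ω ^ 2) ∂μ + ∫⁻ ω, ENNReal.ofReal (v ω ^ 2) ∂μ
        + ∫⁻ ω, ENNReal.ofReal (w ω ^ 2) ∂μ) := by
  rw [← lintegral_add_left (by fun_prop), ← lintegral_add_left (by fun_prop),
    ← lintegral_const_mul' _ _ (by simp)]
  exact lintegral_mono fun ω => ofReal_sq_add_add_le _ _ _

lemma lintegral_sq_const_mul (a : ℝ) (u : Ω → ℝ) :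
    ∫⁻ ω, ENNReal.ofReal ((a * u ω) ^ 2) ∂μ
      = ENNReal.ofReal (a ^ 2) * ∫⁻ ω, ENNReal.ofReal (u ω ^ 2) ∂μ := by
  rw [← lintegral_const_mul' _ _ (by simp)]
  refine lintegral_congr fun ω => ?_
  rw [mul_pow, ENNReal.ofReal_mul (sq_nonneg _)]

variable [IsProbabilityMeasure ν]

lemma lintegral_sq_sum_pi_sub_le {ι : Type*} [Fintype ι] {g : 𝒳 → ℝ} (hg : MemLp g 2 ν) :
    ∫⁻ v : ι → 𝒳, ENNReal.ofReal ((∑ i, (g (v i) - ∫ x, g x ∂ν)) ^ 2) ∂(Measure.pi fun _ => ν)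
      ≤ Fintype.card ι * ∫⁻ x, ENNReal.ofReal (g x ^ 2) ∂ν := by
  set c := ∫ x, g x ∂ν
  have hgc : MemLp (fun x => g x - c) 2 ν := hg.sub (memLp_const c)
  have hL : ∀ i : ι, MemLp (fun v : ι → 𝒳 => g (v i) - c) 2 (Measure.pi fun _ => ν) := fun i =>
    hgc.comp_measurePreserving (measurePreserving_eval (fun _ : ι => ν) i)
  have hS : MemLp (fun v : ι → 𝒳 => ∑ i, (g (v i) - c)) 2 (Measure.pi fun _ => ν) :=
    memLp_finsetSum _ fun i _ => hL i
  have hmean : ∫ v : ι → 𝒳, ∑ i, (g (v i) - c) ∂(Measure.pi fun _ => ν) = 0 := by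
    rw [integral_finsetSum _ fun i _ => (hL i).integrable (by norm_num)]
    refine Finset.sum_eq_zero fun i _ => ?_
    have hmp := measurePreserving_eval (fun _ : ι => ν) i
    have h3 := integral_map (μ := Measure.pi fun _ : ι => ν) hmp.measurable.aemeasurable
      (f := fun x => g x - c) (by rw [hmp.map_eq]; exact hgc.1)
    rw [hmp.map_eq, integral_sub (hg.integrable (by norm_num)) (integrable_const _)] at h3
    simpa [c] using h3.symm
  have hvar := variance_sum_pi (ι := ι) (μ := fun _ => ν) (X := fun _ x => g x - c) fun _ => hgc
  have e1 : (∑ i : ι, fun v : ι → 𝒳 => g (v i) - c) = fun v => ∑ i, (g (v i) - c) := by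
    funext v; simp
  rw [e1, variance_of_integral_eq_zero hS.1.aemeasurable hmean,
    variance_sub_const hg.1, Finset.sum_const, Finset.card_univ, nsmul_eq_mul] at hvar
  rw [← ofReal_integral_eq_lintegral_ofReal hS.integrable_sq (ae_of_all _ fun _ => sq_nonneg _),
    ← ofReal_integral_eq_lintegral_ofReal hg.integrable_sq (ae_of_all _ fun _ => sq_nonneg _),
    hvar, ENNReal.ofReal_mul (by positivity), ENNReal.ofReal_natCast]
  gcongr
  rw [variance_eq_sub hg]
  simp only [Pi.pow_apply]
  linarith [sq_nonneg (ν[g])]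

variable {T : Ω → α} {G : α → 𝒳 → ℝ}

lemma measurable_integral_comp (hT : Measurable T) (hG : Measurable (Function.uncurry G)) :
    Measurable fun ω => ∫ x, G (T ω) x ∂ν := by
  have h : StronglyMeasurable fun t => ∫ x, G t x ∂ν := hG.stronglyMeasurable.integral_prod_right
  exact h.measurable.comp hT

lemma measurable_lintegral_sq (hG : Measurable (Function.uncurry G)) :
    Measurable fun t => ∫⁻ x, ENNReal.ofReal (G t x ^ 2) ∂ν := by
  have h : Measurable fun z : α × 𝒳 => ENNReal.ofReal (Function.uncurry G z ^ 2) := by fun_prop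
  exact h.lintegral_prod_right'

lemma lintegral_sq_integral_le (hT : Measurable T) (hG : Measurable (Function.uncurry G))
    (hfin : ∫⁻ ω, ∫⁻ x, ENNReal.ofReal (G (T ω) x ^ 2) ∂ν ∂μ ≠ ⊤) :
    ∫⁻ ω, ENNReal.ofReal ((∫ x, G (T ω) x ∂ν) ^ 2) ∂μ
      ≤ ∫⁻ ω, ∫⁻ x, ENNReal.ofReal (G (T ω) x ^ 2) ∂ν ∂μ := by
  refine lintegral_mono_ae ?_
  filter_upwards [ae_lt_top ((measurable_lintegral_sq hG).comp hT) hfin] with ω hω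
  have hg : MemLp (G (T ω)) 2 ν :=
    memLp_two_of_lintegral_sq_ne_top (hG.comp measurable_prodMk_left) hω.ne
  rw [← ofReal_integral_eq_lintegral_ofReal hg.integrable_sq (ae_of_all _ fun _ => sq_nonneg _)]
  refine ENNReal.ofReal_le_ofReal ?_
  have := variance_nonneg (G (T ω)) ν
  rw [variance_eq_sub hg] at this
  simpa using this

variable [IsProbabilityMeasure μ]

/-- Independence makes the joint law of sample and training data a product, so with `T` frozen this
is the variance of an i.i.d. sum. The section of `G` is known to be in L² only for almost every
value of `T`. -/
lemma lintegral_sq_sum_sub_le {ι : Type*} [Fintype ι] {V : ι → Ω → 𝒳}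
    (hV : ∀ i, Measurable (V i)) (hlaw : ∀ i, μ.map (V i) = ν) (hind : iIndepFun V μ)
    (hT : Measurable T) (hVT : IndepFun (fun ω i => V i ω) T μ)
    (hG : Measurable (Function.uncurry G))
    (hfin : ∫⁻ ω, ∫⁻ x, ENNReal.ofReal (G (T ω) x ^ 2) ∂ν ∂μ ≠ ⊤) :
    ∫⁻ ω, ENNReal.ofReal ((∑ i, (G (T ω) (V i ω) - ∫ x, G (T ω) x ∂ν)) ^ 2) ∂μ
      ≤ Fintype.card ι * ∫⁻ ω, ∫⁻ x, ENNReal.ofReal (G (T ω) x ^ 2) ∂ν ∂μ := by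
  have hVm : Measurable fun ω i => V i ω := measurable_pi_lambda _ hV
  have hjoint : μ.map (fun ω => ((fun i => V i ω), T ω)) = (Measure.pi fun _ => ν).prod (μ.map T) := by
    rw [(indepFun_iff_map_prod_eq_prod_map_map hVm.aemeasurable hT.aemeasurable).1 hVT,
      hind.map_fun_eq_pi_map fun i => (hV i).aemeasurable]
    simp_rw [hlaw]
  have hc : Measurable fun t => ∫ x, G t x ∂ν := measurable_integral_comp measurable_id hG
  have hΦ : Measurable fun z : (ι → 𝒳) × α =>
      ENNReal.ofReal ((∑ i, (G z.2 (z.1 i) - ∫ x, G z.2 x ∂ν)) ^ 2) := by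
    refine ENNReal.measurable_ofReal.comp (Measurable.pow_const ?_ 2)
    refine Finset.measurable_fun_sum _ fun i _ => Measurable.sub ?_ (hc.comp measurable_snd)
    exact hG.comp (measurable_snd.prodMk ((measurable_pi_apply i).comp measurable_fst))
  have := Measure.isProbabilityMeasure_map hT.aemeasurable (μ := μ)
  rw [← lintegral_map (f := fun z : (ι → 𝒳) × α =>
      ENNReal.ofReal ((∑ i, (G z.2 (z.1 i) - ∫ x, G z.2 x ∂ν)) ^ 2)) hΦ (hVm.prodMk hT),
    hjoint, lintegral_prod_symm' _ hΦ, lintegral_map hΦ.lintegral_prod_left' hT,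
    ← lintegral_const_mul' _ _ (ENNReal.natCast_ne_top _)]
  refine lintegral_mono_ae ?_
  filter_upwards [ae_lt_top ((measurable_lintegral_sq hG).comp hT) hfin] with ω hω
  exact lintegral_sq_sum_pi_sub_le
    (memLp_two_of_lintegral_sq_ne_top (hG.comp measurable_prodMk_left) hω.ne)

/-- The second moment of a cross-fitted weighted sum: the predictor error `G (T ω)` is evaluated at
two independent samples `V`, `W`, both independent of the training data `T`. -/
lemma lintegral_sq_crossfit_le {ι κ : Type*} [Fintype ι] [Fintype κ] {V : ι → Ω → 𝒳}
    {W : κ → Ω → 𝒳} (hV : ∀ i, Measurable (V i)) (hVlaw : ∀ i, μ.map (V i) = ν)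
    (hVind : iIndepFun V μ) (hW : ∀ i, Measurable (W i)) (hWlaw : ∀ i, μ.map (W i) = ν)
    (hWind : iIndepFun W μ) (hT : Measurable T) (hVT : IndepFun (fun ω i => V i ω) T μ)
    (hWT : IndepFun (fun ω i => W i ω) T μ) (hG : Measurable (Function.uncurry G))
    (hfin : ∫⁻ ω, ∫⁻ x, ENNReal.ofReal (G (T ω) x ^ 2) ∂ν ∂μ ≠ ⊤) (a b : ℝ) :
    ∫⁻ ω, ENNReal.ofReal ((a * ∑ i, G (T ω) (V i ω) + b * ∑ j, G (T ω) (W j ω)) ^ 2) ∂μ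
      ≤ ENNReal.ofReal (3 * (a ^ 2 * Fintype.card ι + b ^ 2 * Fintype.card κ
          + (a * Fintype.card ι + b * Fintype.card κ) ^ 2))
        * ∫⁻ ω, ∫⁻ x, ENNReal.ofReal (G (T ω) x ^ 2) ∂ν ∂μ := by
  have hc : Measurable fun ω => ∫ x, G (T ω) x ∂ν := measurable_integral_comp hT hG
  have hm : ∀ {X : Ω → 𝒳}, Measurable X → Measurable fun ω => G (T ω) (X ω) := fun hX =>
    hG.comp (hT.prodMk hX)
  -- Centre at the conditional mean given `T`. The last term carries the total weight of the fold,
  -- which balanced folds make small.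
  have e : ∀ ω, a * ∑ i, G (T ω) (V i ω) + b * ∑ j, G (T ω) (W j ω)
      = a * ∑ i, (G (T ω) (V i ω) - ∫ x, G (T ω) x ∂ν)
        + b * ∑ j, (G (T ω) (W j ω) - ∫ x, G (T ω) x ∂ν)
        + (a * Fintype.card ι + b * Fintype.card κ) * ∫ x, G (T ω) x ∂ν := by
    intro ω
    simp only [Finset.sum_sub_distrib, Finset.sum_const, Finset.card_univ, nsmul_eq_mul]
    ring
  simp_rw [e]
  refine (lintegral_sq_add_add_le ?_ ?_).trans ?_
  · exact (Finset.measurable_fun_sum _ fun i _ => (hm (hV i)).sub hc).const_mul a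
  · exact (Finset.measurable_fun_sum _ fun i _ => (hm (hW i)).sub hc).const_mul b
  · rw [lintegral_sq_const_mul, lintegral_sq_const_mul, lintegral_sq_const_mul]
    have h1 := lintegral_sq_sum_sub_le hV hVlaw hVind hT hVT hG hfin
    have h2 := lintegral_sq_sum_sub_le hW hWlaw hWind hT hWT hG hfin
    have h3 := lintegral_sq_integral_le hT hG hfin
    refine (mul_le_mul_right (add_le_add (add_le_add (mul_le_mul_right h1 _) (mul_le_mul_right h2 _))
      (mul_le_mul_right h3 _)) _).trans (le_of_eq ?_)
    rw [ENNReal.ofReal_mul (by norm_num), ENNReal.ofReal_add (by positivity) (by positivity),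
      ENNReal.ofReal_add (by positivity) (by positivity), ENNReal.ofReal_mul (by positivity),
      ENNReal.ofReal_mul (by positivity), ENNReal.ofReal_natCast, ENNReal.ofReal_natCast]
    simp only [ENNReal.ofReal_ofNat]
    ring

end CrossFit

/-! ### The projection and the degenerate part of a symmetric kernel -/

section Projection

variable {𝒳 𝒴 : Type*} [MeasurableSpace 𝒳] [MeasurableSpace 𝒴] {P : Measure (𝒳 × 𝒴)}
  [IsProbabilityMeasure P] {r : ℕ} {ℓ : (Fin r → 𝒴) → ℝ}

instance : IsProbabilityMeasure (responseLaw P r) := by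
  unfold responseLaw
  infer_instance

lemma ae_memLp_update (hℓ : Measurable ℓ) (hℓ2 : MemLp ℓ 2 (responseLaw P r)) (k : Fin r) :
    ∀ᵐ y ∂P.snd, MemLp (fun v => ℓ (Function.update v k y)) 2 (responseLaw P r) := by
  have hmp := measurePreserving_update (Q := P.snd) k
  have h := (hmp.integrable_comp_of_integrable hℓ2.integrable_sq).prod_right_ae
  filter_upwards [h] with y hy
  rw [memLp_two_iff_integrable_sq]
  · exact hy
  · exact ((hℓ.comp hmp.measurable).comp measurable_prodMk_left).aestronglyMeasurable

variable [NeZero r]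

lemma measurable_ell1 (hℓ : Measurable ℓ) : Measurable (ell1 P ℓ) := by
  have h : Measurable fun z : 𝒴 × (Fin r → 𝒴) => ℓ (Function.update z.2 0 z.1) :=
    hℓ.comp (measurePreserving_update (Q := P.snd) (0 : Fin r)).measurable
  have h' : StronglyMeasurable fun y => ∫ v, ℓ (Function.update v 0 y) ∂(responseLaw P r) := by
    unfold responseLaw
    exact h.stronglyMeasurable.integral_prod_right'
  exact h'.measurable

/-- Exchange positions 0 and `k`: the kernel is symmetric and the product law is exchangeable.
Symmetry of the kernel enters the proof here. -/
lemma integral_update_eq_ell1 (hℓ : Measurable ℓ) (hs : IsSymmetricKernel ℓ) (k : Fin r) (y : 𝒴) :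
    ∫ v, ℓ (Function.update v k y) ∂(responseLaw P r) = ell1 P ℓ y := by
  have hmp := measurePreserving_comp_injective (𝒴 := 𝒴) (Q := P.snd) (Equiv.swap 0 k).injective
  have hmeas : Measurable fun v : Fin r → 𝒴 => ℓ (Function.update v 0 y) :=
    (hℓ.comp (measurePreserving_update (Q := P.snd) (0 : Fin r)).measurable).comp
      measurable_prodMk_left
  have h3 := integral_map (μ := Measure.pi fun _ : Fin r => P.snd) hmp.measurable.aemeasurable
    (f := fun v : Fin r → 𝒴 => ℓ (Function.update v 0 y)) hmeas.aestronglyMeasurable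
  rw [hmp.map_eq] at h3
  unfold ell1 responseLaw
  rw [h3]
  refine integral_congr_ae (ae_of_all _ fun v => ?_)
  simp only
  rw [← hs (Equiv.swap 0 k) (Function.update v k y)]
  congr 1
  funext i
  by_cases hi : i = 0
  · subst hi; simp
  · have : Equiv.swap 0 k i ≠ k := by
      intro hc
      have := congrArg (Equiv.swap 0 k) hc
      simp at this
      exact hi this
    simp [Function.update_of_ne this, Function.update_of_ne hi]

lemma memLp_ell1 (hℓ : Measurable ℓ) (hℓ2 : MemLp ℓ 2 (responseLaw P r)) :
    MemLp (ell1 P ℓ) 2 P.snd := by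
  have hmp := measurePreserving_update (Q := P.snd) (0 : Fin r)
  rw [memLp_two_iff_integrable_sq (measurable_ell1 hℓ).aestronglyMeasurable]
  have h := (hmp.integrable_comp_of_integrable hℓ2.integrable_sq).integral_prod_left
  refine h.mono' ((measurable_ell1 hℓ).pow_const 2).aestronglyMeasurable ?_
  filter_upwards [ae_memLp_update hℓ hℓ2 0] with y hy
  rw [Real.norm_of_nonneg (sq_nonneg _)]
  have hv := variance_nonneg (fun v => ℓ (Function.update v 0 y)) (responseLaw P r)
  rw [variance_eq_sub hy] at hv
  simpa [ell1, responseLaw] using hv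

lemma integral_ell1 (hℓ2 : MemLp ℓ 2 (responseLaw P r)) : ∫ y, ell1 P ℓ y ∂P.snd = psi P ℓ := by
  have hmp := measurePreserving_update (Q := P.snd) (0 : Fin r)
  have hi := hℓ2.integrable (by norm_num)
  have h1 := integral_prod _ (hmp.integrable_comp_of_integrable hi)
  have h3 := integral_map hmp.measurable.aemeasurable (f := ℓ) (by rw [hmp.map_eq]; exact hi.1)
  rw [hmp.map_eq] at h3
  simp only [Function.comp_def] at h1
  unfold psi ell1 responseLaw
  rw [h3, h1]

/-- The completely degenerate part of the kernel in its Hoeffding decomposition. -/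
def degeneratePart (P : Measure (𝒳 × 𝒴)) (ℓ : (Fin r → 𝒴) → ℝ) (v : Fin r → 𝒴) : ℝ :=
  ℓ v - psi P ℓ - ∑ k, (ell1 P ℓ (v k) - psi P ℓ)

lemma measurable_degeneratePart (hℓ : Measurable ℓ) : Measurable (degeneratePart P ℓ) := by
  have := measurable_ell1 (P := P) hℓ
  unfold degeneratePart
  fun_prop

lemma memLp_ell1_apply (hℓ : Measurable ℓ) (hℓ2 : MemLp ℓ 2 (responseLaw P r)) (k : Fin r) :
    MemLp (fun v : Fin r → 𝒴 => ell1 P ℓ (v k) - psi P ℓ) 2 (Measure.pi fun _ => P.snd) :=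
  ((memLp_ell1 hℓ hℓ2).sub (memLp_const _)).comp_measurePreserving
    (measurePreserving_eval (fun _ : Fin r => P.snd) k)

lemma memLp_degeneratePart (hℓ : Measurable ℓ) (hℓ2 : MemLp ℓ 2 (responseLaw P r)) :
    MemLp (degeneratePart P ℓ) 2 (Measure.pi fun _ => P.snd) :=
  (hℓ2.sub (memLp_const _)).sub (memLp_finsetSum _ fun k _ => memLp_ell1_apply hℓ hℓ2 k)

lemma integral_ell1_apply_sub (hℓ : Measurable ℓ) (hℓ2 : MemLp ℓ 2 (responseLaw P r)) (k : Fin r) :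
    ∫ v : Fin r → 𝒴, (ell1 P ℓ (v k) - psi P ℓ) ∂(Measure.pi fun _ => P.snd) = 0 := by
  have hmp := measurePreserving_eval (fun _ : Fin r => P.snd) k
  have h3 := integral_map (μ := Measure.pi fun _ : Fin r => P.snd) hmp.measurable.aemeasurable
    (f := fun y => ell1 P ℓ y - psi P ℓ)
    ((measurable_ell1 hℓ).sub_const _).aestronglyMeasurable
  rw [hmp.map_eq, integral_sub ((memLp_ell1 hℓ hℓ2).integrable (by norm_num))
    (integrable_const _), integral_ell1 hℓ2] at h3
  simpa using h3.symm

/-- Given coordinate k equal to y, the kernel averages to ℓ₁(y), the k-th projection term is ℓ₁(y) −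
ψ, and the other terms average to zero. The statement is almost sure because sections of `ℓ` are
integrable only for almost every y. -/
lemma integral_degeneratePart_update (hℓ : Measurable ℓ) (hs : IsSymmetricKernel ℓ)
    (hℓ2 : MemLp ℓ 2 (responseLaw P r)) (k : Fin r) :
    ∀ᵐ y ∂P.snd, ∫ v, degeneratePart P ℓ (Function.update v k y)
      ∂(Measure.pi fun _ => P.snd) = 0 := by
  filter_upwards [ae_memLp_update hℓ hℓ2 k] with y hy
  have hi1 : Integrable (fun v => ℓ (Function.update v k y)) (Measure.pi fun _ => P.snd) :=
    hy.integrable (by norm_num)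
  have hterm : ∀ j : Fin r, (fun v : Fin r → 𝒴 => ell1 P ℓ (Function.update v k y j) - psi P ℓ)
      = if j = k then fun _ => ell1 P ℓ y - psi P ℓ else fun v => ell1 P ℓ (v j) - psi P ℓ := by
    intro j
    by_cases hj : j = k
    · subst hj; simp
    · simp [hj]
  have hi2 : ∀ j : Fin r, Integrable
      (fun v : Fin r → 𝒴 => ell1 P ℓ (Function.update v k y j) - psi P ℓ)
      (Measure.pi fun _ => P.snd) := by
    intro j
    rw [hterm]
    split_ifs
    · exact integrable_const _
    · exact (memLp_ell1_apply hℓ hℓ2 j).integrable (by norm_num)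
  have hval : ∀ j : Fin r, ∫ v : Fin r → 𝒴, (ell1 P ℓ (Function.update v k y j) - psi P ℓ)
      ∂(Measure.pi fun _ => P.snd) = if j = k then ell1 P ℓ y - psi P ℓ else 0 := by
    intro j
    rw [hterm]
    split_ifs
    · simp
    · exact integral_ell1_apply_sub hℓ hℓ2 j
  unfold degeneratePart
  rw [integral_sub (by exact hi1.sub (integrable_const _)) (integrable_finsetSum _ fun j _ => hi2 j),
    integral_sub hi1 (integrable_const _), integral_finsetSum _ fun j _ => hi2 j]
  have := integral_update_eq_ell1 (P := P) hℓ hs k y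
  unfold responseLaw at this
  rw [this]
  simp [hval]

end Projection

/-! ### The Hoeffding decomposition of the U-statistic -/

section Hoeffding

variable {Ω 𝒳 𝒴 : Type*} [MeasurableSpace 𝒳] [MeasurableSpace 𝒴]
  {P : Measure (𝒳 × 𝒴)} {n r : ℕ} [NeZero r] {ℓ : (Fin r → 𝒴) → ℝ} {Z : Fin n → Ω → 𝒳 × 𝒴}

/-- For each slot k, averaging a function of `e k` over all embeddings gives the sample mean; the r
slots together produce the factor r/n. -/
lemma uStat_sub_psi_eq (hn : r ≤ n) (ω : Ω) :
    uStat ℓ Z ω - psi P ℓ = uStat (degeneratePart P ℓ) Z ω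
      + (r : ℝ) / n * ∑ i, (ell1 P ℓ (Z i ω).2 - psi P ℓ) := by
  have hr : 0 < r := Nat.pos_of_ne_zero (NeZero.ne r)
  have hn0 : 0 < n := hr.trans_le hn
  have : Nonempty (Fin n) := ⟨⟨0, hn0⟩⟩
  have hD : (n.descFactorial r : ℝ) ≠ 0 := Nat.cast_ne_zero.2 (Nat.descFactorial_pos.2 hn).ne'
  have hcard : Fintype.card (Fin r ↪ Fin n) = n.descFactorial r := by
    simp [Fintype.card_embedding_eq]
  unfold uStat degeneratePart
  simp only [Finset.sum_sub_distrib (s := (Finset.univ : Finset (Fin r ↪ Fin n)))]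
  rw [Finset.sum_comm (s := (Finset.univ : Finset (Fin r ↪ Fin n)))]
  have h2 := fun k : Fin r => sum_embedding_apply (κ := Fin n) k
    fun i => ell1 P ℓ (Z i ω).2 - psi P ℓ
  simp only [h2, hcard, Finset.sum_const, Finset.card_univ, nsmul_eq_mul, Fintype.card_fin]
  have hn' : (n : ℝ) ≠ 0 := by positivity
  field_simp
  ring

lemma lintegral_sq_uStat_degeneratePart_le [MeasurableSpace Ω] [IsProbabilityMeasure P] {μ : Measure Ω}
    [IsProbabilityMeasure μ] (hℓ : Measurable ℓ) (hs : IsSymmetricKernel ℓ)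
    (hℓ2 : MemLp ℓ 2 (responseLaw P r)) (hZ : ∀ i, Measurable (Z i))
    (hlaw : ∀ i, μ.map (Z i) = P) (hind : iIndepFun Z μ) (hn : r ≤ n) (hn2 : 2 ≤ n) :
    ∫⁻ ω, ENNReal.ofReal (uStat (degeneratePart P ℓ) Z ω ^ 2) ∂μ
      ≤ ENNReal.ofReal ((r : ℝ) ^ 4 / (n * (n - 1))
        * ∫ v, degeneratePart P ℓ v ^ 2 ∂(Measure.pi fun _ => P.snd)) := by
  classical
  have : Nonempty (Fin r) := ⟨0⟩
  set D : ℝ := (n.descFactorial r : ℝ) with hD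
  have hD0 : D ≠ 0 := Nat.cast_ne_zero.2 (Nat.descFactorial_pos.2 hn).ne'
  set g := degeneratePart P ℓ
  have hgm : Measurable g := measurable_degeneratePart hℓ
  have hg : MemLp g 2 (Measure.pi fun _ => P.snd) := memLp_degeneratePart hℓ hℓ2
  let Φ : (Fin n → 𝒴) → ℝ := fun y => D⁻¹ * ∑ e : Fin r ↪ Fin n, g fun i => y (e i)
  have hΦ : Measurable Φ := by
    refine Measurable.const_mul (Finset.measurable_fun_sum _ fun e _ => hgm.comp ?_) _
    exact measurable_pi_lambda _ fun i => measurable_pi_apply _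
  have hΦ2 : MemLp Φ 2 (Measure.pi fun _ => P.snd) :=
    (memLp_finsetSum _ fun e _ => memLp_comp_injective hg e.injective).const_mul _
  have hmap : μ.map (fun ω i => (Z i ω).2) = Measure.pi fun _ => P.snd := by
    have h1 := hind.comp (fun _ => Prod.snd) (fun _ => measurable_snd)
    have h2 := h1.map_fun_eq_pi_map fun i => (measurable_snd.comp (hZ i)).aemeasurable
    have h3 : ∀ i, μ.map (Prod.snd ∘ Z i) = P.snd := fun i => by
      rw [← Measure.map_map measurable_snd (hZ i), hlaw i, Measure.snd]
    simp_rw [h3] at h2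
    exact h2
  have hYm : Measurable fun ω i => (Z i ω).2 :=
    measurable_pi_lambda _ fun i => measurable_snd.comp (hZ i)
  have e1 : ∫⁻ ω, ENNReal.ofReal (uStat g Z ω ^ 2) ∂μ
      = ∫⁻ y, ENNReal.ofReal (Φ y ^ 2) ∂(Measure.pi fun _ => P.snd) := by
    rw [← hmap, lintegral_map (by fun_prop) hYm]
    rfl
  rw [e1, ← ofReal_integral_eq_lintegral_ofReal hΦ2.integrable_sq
    (ae_of_all _ fun _ => sq_nonneg _)]
  refine ENNReal.ofReal_le_ofReal ?_
  have h := integral_sq_sum_le_of_degenerate (κ := Fin n) hgm hg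
    (integral_degeneratePart_update hℓ hs hℓ2) (by simpa using hn2)
  have hcard : Fintype.card (Fin r ↪ Fin n) = n.descFactorial r := by
    simp [Fintype.card_embedding_eq]
  simp only [hcard, Fintype.card_fin] at h
  simp only [Φ, mul_pow]
  rw [integral_const_mul]
  calc _ ≤ D⁻¹ ^ 2 * _ := mul_le_mul_of_nonneg_left h (sq_nonneg _)
    _ = _ := by
      rw [← hD]
      field_simp

end Hoeffding

/-! ### The asymptotic variance -/

section AsymptoticVariance

variable {𝒳 𝒴 : Type*} [MeasurableSpace 𝒳] [MeasurableSpace 𝒴] {P : Measure (𝒳 × 𝒴)}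
  {r : ℕ} [NeZero r] {ℓ : (Fin r → 𝒴) → ℝ} {f : 𝒳 → ℝ}

lemma integral_fst_eq (hf : Measurable f) : ∫ z, f z.1 ∂P = ∫ x, f x ∂P.fst := by
  rw [Measure.fst, integral_map measurable_fst.aemeasurable hf.aestronglyMeasurable]

lemma memLp_comp_fst (hf2 : MemLp f 2 P.fst) : MemLp (fun z : 𝒳 × 𝒴 => f z.1) 2 P :=
  hf2.comp_measurePreserving ⟨measurable_fst, rfl⟩

variable [IsProbabilityMeasure P]

lemma memLp_ell1Y (hℓ : Measurable ℓ) (hℓ2 : MemLp ℓ 2 (responseLaw P r)) :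
    MemLp (ell1Y P ℓ) 2 P :=
  (memLp_ell1 hℓ hℓ2).comp_measurePreserving ⟨measurable_snd, rfl⟩

lemma integral_ell1Y (hℓ : Measurable ℓ) (hℓ2 : MemLp ℓ 2 (responseLaw P r)) :
    ∫ z, ell1Y P ℓ z ∂P = psi P ℓ := by
  rw [← integral_ell1 hℓ2, Measure.snd, integral_map measurable_snd.aemeasurable
    (measurable_ell1 hℓ).aestronglyMeasurable]
  rfl

lemma memLp_psi1X (hℓ : Measurable ℓ) (hℓ2 : MemLp ℓ 2 (responseLaw P r)) :
    MemLp (psi1X P ℓ) 2 P :=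
  (memLp_ell1Y hℓ hℓ2).condExp (by norm_num)

/-- Pull f(X) out of the conditional expectation given X. This removes ψ₁ from Λ, leaving only
quantities that occur in the linear statistic. -/
lemma cov_psi1X_eq (hℓ : Measurable ℓ) (hℓ2 : MemLp ℓ 2 (responseLaw P r)) (hf : Measurable f)
    (hf2 : MemLp f 2 P.fst) :
    cov[fun z => f z.1, psi1X P ℓ; P] = cov[fun z => f z.1, ell1Y P ℓ; P] := by
  have hF := memLp_comp_fst hf2
  have hL := memLp_ell1Y hℓ hℓ2
  have hm : (sigmaX : MeasurableSpace (𝒳 × 𝒴)) ≤ Prod.instMeasurableSpace :=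
    measurable_fst.comap_le
  rw [covariance_eq_sub hF (memLp_psi1X hℓ hℓ2), covariance_eq_sub hF hL]
  have h1 : ∫ z, psi1X P ℓ z ∂P = ∫ z, ell1Y P ℓ z ∂P := integral_condExp hm
  rw [h1]
  congr 1
  have hsm : StronglyMeasurable[sigmaX] fun z : 𝒳 × 𝒴 => f z.1 :=
    hf.stronglyMeasurable.comp_measurable (comap_measurable Prod.fst)
  have h2 := condExp_mul_of_stronglyMeasurable_left (μ := P) hsm (hF.integrable_mul hL)
    (hL.integrable (by norm_num))
  rw [← integral_condExp hm (f := (fun z : 𝒳 × 𝒴 => f z.1) * ell1Y P ℓ), integral_congr_ae h2]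
  rfl

/-- Var f(X) − 2 Cov(f(X), ψ₁(X)) = Var(f(X) − ψ₁(X)) − Var ψ₁(X) ≥ −Var ψ₁(X). Since λ ≤ 1, at most
the explained part of Var ℓ₁(Y) is lost, uniformly in n and m. -/
lemma Lam_ge (hℓ : Measurable ℓ) (hℓ2 : MemLp ℓ 2 (responseLaw P r))
    (hf2 : MemLp f 2 P.fst) (n m : ℕ) :
    (r : ℝ) ^ 2 * expCondVar P ℓ ≤ Lam P ℓ f n m := by
  have hF := memLp_comp_fst hf2
  have hL := memLp_ell1Y hℓ hℓ2
  have hψ := memLp_psi1X hℓ hℓ2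
  have hm : (sigmaX : MeasurableSpace (𝒳 × 𝒴)) ≤ Prod.instMeasurableSpace :=
    measurable_fst.comap_le
  have h1 : expCondVar P ℓ + Var[psi1X P ℓ; P] = Var[ell1Y P ℓ; P] :=
    integral_condVar_add_variance_condExp hm hL
  have h2 := variance_nonneg ((fun z : 𝒳 × 𝒴 => f z.1) - psi1X P ℓ) P
  rw [variance_sub hF hψ] at h2
  have h3 := variance_nonneg (psi1X P ℓ) P
  set lam : ℝ := (m : ℝ) / (n + m)
  have hl0 : 0 ≤ lam := by positivity
  have hl1 : lam ≤ 1 := div_le_one_of_le₀ (by linarith [Nat.cast_nonneg (α := ℝ) n]) (by positivity)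
  have e : Lam P ℓ f n m = (r : ℝ) ^ 2 * (Var[ell1Y P ℓ; P]
      + lam * (Var[fun z => f z.1; P] - 2 * cov[fun z => f z.1, psi1X P ℓ; P])) := by
    unfold Lam
    rw [mul_div_assoc]
    ring
  rw [e]
  refine mul_le_mul_of_nonneg_left ?_ (sq_nonneg _)
  nlinarith

lemma Lam_eq (hℓ : Measurable ℓ) (hℓ2 : MemLp ℓ 2 (responseLaw P r)) (hf : Measurable f)
    (hf2 : MemLp f 2 P.fst) (n m : ℕ) :
    Lam P ℓ f n m = (r : ℝ) ^ 2 *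
      (∫ z, (ell1Y P ℓ z - psi P ℓ
          - (m : ℝ) / (n + m) * (f z.1 - ∫ x, f x ∂P.fst)) ^ 2 ∂P
        + (m : ℝ) / (n + m) * (1 - (m : ℝ) / (n + m))
          * ∫ x, (f x - ∫ x, f x ∂P.fst) ^ 2 ∂P.fst) := by
  have hF := memLp_comp_fst hf2
  have hL := memLp_ell1Y hℓ hℓ2
  have hFc : MemLp (fun z : 𝒳 × 𝒴 => f z.1 - ∫ x, f x ∂P.fst) 2 P := hF.sub (memLp_const _)
  have hLc : MemLp (fun z : 𝒳 × 𝒴 => ell1Y P ℓ z - psi P ℓ) 2 P := hL.sub (memLp_const _)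
  have hvF : Var[fun z => f z.1; P] = ∫ z, (f z.1 - ∫ x, f x ∂P.fst) ^ 2 ∂P := by
    rw [variance_eq_integral hF.1.aemeasurable, integral_fst_eq hf]
  have hvL : Var[ell1Y P ℓ; P] = ∫ z, (ell1Y P ℓ z - psi P ℓ) ^ 2 ∂P := by
    rw [variance_eq_integral hL.1.aemeasurable, integral_ell1Y hℓ hℓ2]
  have hcov : cov[fun z => f z.1, psi1X P ℓ; P]
      = ∫ z, (f z.1 - ∫ x, f x ∂P.fst) * (ell1Y P ℓ z - psi P ℓ) ∂P := by
    rw [cov_psi1X_eq hℓ hℓ2 hf hf2, covariance, integral_fst_eq hf, integral_ell1Y hℓ hℓ2]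
  have hF' : ∫ x, (f x - ∫ x, f x ∂P.fst) ^ 2 ∂P.fst = ∫ z, (f z.1 - ∫ x, f x ∂P.fst) ^ 2 ∂P :=
    (integral_fst_eq ((hf.sub_const _).pow_const 2)).symm
  unfold Lam
  rw [hvF, hvL, hcov, hF', mul_div_assoc]
  set lam : ℝ := (m : ℝ) / (n + m)
  have hx : ∀ z : 𝒳 × 𝒴, (ell1Y P ℓ z - psi P ℓ - lam * (f z.1 - ∫ x, f x ∂P.fst)) ^ 2
      = (ell1Y P ℓ z - psi P ℓ) ^ 2
        - 2 * lam * ((f z.1 - ∫ x, f x ∂P.fst) * (ell1Y P ℓ z - psi P ℓ))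
        + lam ^ 2 * (f z.1 - ∫ x, f x ∂P.fst) ^ 2 := fun z => by ring
  simp_rw [hx]
  have i1 := hLc.integrable_sq
  have i2 : Integrable (fun z : 𝒳 × 𝒴 => 2 * lam * ((f z.1 - ∫ x, f x ∂P.fst)
      * (ell1Y P ℓ z - psi P ℓ))) P := (hFc.integrable_mul hLc).const_mul _
  have i3 := hFc.integrable_sq.const_mul (lam ^ 2)
  rw [integral_add (by exact i1.sub i2) i3, integral_sub i1 i2, integral_const_mul,
    integral_const_mul]
  ring

end AsymptoticVariance

/-! ### Weighted sums over two independent i.i.d. samples -/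

section TwoSample

variable {Ω α β : Type*} [MeasurableSpace Ω] [MeasurableSpace α] [MeasurableSpace β]
  {μ : Measure Ω} {ρ : Measure α} {ν : Measure β} {ι κ : Type*} [Fintype ι] [Fintype κ]
  {Z : ι → Ω → α} {W : κ → Ω → β} {A : α → ℝ} {F : β → ℝ}

lemma charFun_map_sum_comp (hZ : ∀ i, Measurable (Z i)) (hZlaw : ∀ i, μ.map (Z i) = ρ)
    (hZind : iIndepFun Z μ) (hA : Measurable A) (c t : ℝ) :
    charFun (μ.map fun ω => c * ∑ i, A (Z i ω)) t
      = charFun (ρ.map A) (c * t) ^ Fintype.card ι := by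
  have hm : ∀ i, Measurable fun ω => A (Z i ω) := fun i => hA.comp (hZ i)
  have h : charFun (μ.map fun ω => ∑ i, A (Z i ω)) = ∏ i, charFun (μ.map fun ω => A (Z i ω)) :=
    iIndepFun.charFun_map_fun_sum_eq_prod (fun i => (hm i).aemeasurable)
      (hZind.comp (fun _ => A) fun _ => hA)
  rw [charFun_map_mul_comp (Finset.measurable_fun_sum _ fun i _ => hm i).aemeasurable]
  rw [h, Finset.prod_apply]
  have e : ∀ i, μ.map (fun ω => A (Z i ω)) = ρ.map A := fun i => by
    rw [← hZlaw i, Measure.map_map hA (hZ i)]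
    rfl
  simp [e]

lemma memLp_comp_of_map_eq {X : Ω → α} (hX : Measurable X) (hlaw : μ.map X = ρ)
    (hA2 : MemLp A 2 ρ) : MemLp (fun ω => A (X ω)) 2 μ :=
  hA2.comp_measurePreserving ⟨hX, hlaw⟩

lemma memLp_sum_comp (hZ : ∀ i, Measurable (Z i)) (hZlaw : ∀ i, μ.map (Z i) = ρ)
    (hA2 : MemLp A 2 ρ) : MemLp (fun ω => ∑ i, A (Z i ω)) 2 μ :=
  memLp_finsetSum _ fun i _ => memLp_comp_of_map_eq (hZ i) (hZlaw i) hA2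

variable [IsProbabilityMeasure μ]

lemma charFun_map_two_sample (hZ : ∀ i, Measurable (Z i)) (hZlaw : ∀ i, μ.map (Z i) = ρ)
    (hZind : iIndepFun Z μ) (hW : ∀ i, Measurable (W i)) (hWlaw : ∀ i, μ.map (W i) = ν)
    (hWind : iIndepFun W μ) (hZW : IndepFun (fun ω i => Z i ω) (fun ω j => W j ω) μ)
    (hA : Measurable A) (hF : Measurable F) (c d t : ℝ) :
    charFun (μ.map fun ω => c * ∑ i, A (Z i ω) + d * ∑ j, F (W j ω)) t
      = charFun (ρ.map A) (c * t) ^ Fintype.card ι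
        * charFun (ν.map F) (d * t) ^ Fintype.card κ := by
  have hmZ : Measurable fun v : ι → α => c * ∑ i, A (v i) := by fun_prop
  have hmW : Measurable fun v : κ → β => d * ∑ i, F (v i) := by fun_prop
  have h1 : IndepFun (fun ω => c * ∑ i, A (Z i ω)) (fun ω => d * ∑ j, F (W j ω)) μ :=
    hZW.comp hmZ hmW
  rw [h1.charFun_map_fun_add_eq_mul (by fun_prop) (by fun_prop), Pi.mul_apply,
    charFun_map_sum_comp hZ hZlaw hZind hA, charFun_map_sum_comp hW hWlaw hWind hF]

lemma integral_sum_comp_eq_zero (hZ : ∀ i, Measurable (Z i)) (hZlaw : ∀ i, μ.map (Z i) = ρ)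
    (hA2 : MemLp A 2 ρ) (hA0 : ∫ a, A a ∂ρ = 0) : ∫ ω, ∑ i, A (Z i ω) ∂μ = 0 := by
  rw [integral_finsetSum _ fun i _ =>
    (memLp_comp_of_map_eq (hZ i) (hZlaw i) hA2).integrable (by norm_num)]
  refine Finset.sum_eq_zero fun i _ => ?_
  rw [← integral_map (f := A) (hZ i).aemeasurable (by rw [hZlaw i]; exact hA2.1), hZlaw i, hA0]

lemma integral_sq_sum_comp (hZ : ∀ i, Measurable (Z i)) (hZlaw : ∀ i, μ.map (Z i) = ρ)
    (hZind : iIndepFun Z μ) (hA : Measurable A) (hA2 : MemLp A 2 ρ) (hA0 : ∫ a, A a ∂ρ = 0) :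
    ∫ ω, (∑ i, A (Z i ω)) ^ 2 ∂μ = Fintype.card ι * ∫ a, A a ^ 2 ∂ρ := by
  have hL := fun i => memLp_comp_of_map_eq (hZ i) (hZlaw i) hA2
  have hcomp := hZind.comp (fun _ => A) fun _ => hA
  have hvar := IndepFun.variance_sum (μ := μ) (s := Finset.univ) (X := fun i ω => A (Z i ω))
    (fun i _ => hL i) (fun i _ j _ hij => hcomp.indepFun hij)
  have e1 : (∑ i, fun ω => A (Z i ω)) = fun ω => ∑ i, A (Z i ω) := by
    funext ω; simp
  rw [e1, variance_of_integral_eq_zero (memLp_sum_comp hZ hZlaw hA2).1.aemeasurable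
    (integral_sum_comp_eq_zero hZ hZlaw hA2 hA0)] at hvar
  have e2 : ∀ i, Var[fun ω => A (Z i ω); μ] = ∫ a, A a ^ 2 ∂ρ := by
    intro i
    have h0 : ∫ ω, A (Z i ω) ∂μ = 0 := by
      rw [← integral_map (f := A) (hZ i).aemeasurable (by rw [hZlaw i]; exact hA2.1), hZlaw i, hA0]
    rw [variance_of_integral_eq_zero (hL i).1.aemeasurable h0, ← hZlaw i,
      integral_map (hZ i).aemeasurable (by fun_prop)]
  simpa [e2] using hvar

lemma integral_sq_two_sample (hZ : ∀ i, Measurable (Z i)) (hZlaw : ∀ i, μ.map (Z i) = ρ)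
    (hZind : iIndepFun Z μ) (hW : ∀ i, Measurable (W i)) (hWlaw : ∀ i, μ.map (W i) = ν)
    (hWind : iIndepFun W μ) (hZW : IndepFun (fun ω i => Z i ω) (fun ω j => W j ω) μ)
    (hA : Measurable A) (hA2 : MemLp A 2 ρ) (hA0 : ∫ a, A a ∂ρ = 0)
    (hF : Measurable F) (hF2 : MemLp F 2 ν) (hF0 : ∫ b, F b ∂ν = 0) (c d : ℝ) :
    ∫ ω, (c * ∑ i, A (Z i ω) + d * ∑ j, F (W j ω)) ^ 2 ∂μ
      = Fintype.card ι * c ^ 2 * ∫ a, A a ^ 2 ∂ρ + Fintype.card κ * d ^ 2 * ∫ b, F b ^ 2 ∂ν := by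
  have hS := memLp_sum_comp hZ hZlaw hA2
  have hT := memLp_sum_comp hW hWlaw hF2
  have hmZ : Measurable fun v : ι → α => ∑ i, A (v i) := by fun_prop
  have hmW : Measurable fun v : κ → β => ∑ i, F (v i) := by fun_prop
  have h1 : IndepFun (fun ω => ∑ i, A (Z i ω)) (fun ω => ∑ j, F (W j ω)) μ :=
    hZW.comp hmZ hmW
  have hcross : ∫ ω, (∑ i, A (Z i ω)) * (∑ j, F (W j ω)) ∂μ = 0 := by
    rw [h1.integral_fun_mul_eq_mul_integral hS.1 hT.1,
      integral_sum_comp_eq_zero hZ hZlaw hA2 hA0, zero_mul]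
  have e : ∀ ω, (c * ∑ i, A (Z i ω) + d * ∑ j, F (W j ω)) ^ 2
      = c ^ 2 * (∑ i, A (Z i ω)) ^ 2 + 2 * c * d * ((∑ i, A (Z i ω)) * ∑ j, F (W j ω))
        + d ^ 2 * (∑ j, F (W j ω)) ^ 2 := fun ω => by ring
  simp_rw [e]
  have i1 := hS.integrable_sq.const_mul (c ^ 2)
  have i2 : Integrable (fun ω => 2 * c * d * ((∑ i, A (Z i ω)) * ∑ j, F (W j ω))) μ :=
    (hS.integrable_mul hT).const_mul _
  have i3 := hT.integrable_sq.const_mul (d ^ 2)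
  rw [integral_add (by exact i1.add i2) i3, integral_add i1 i2, integral_const_mul,
    integral_const_mul, integral_const_mul, hcross, integral_sq_sum_comp hZ hZlaw hZind hA hA2 hA0,
    integral_sq_sum_comp hW hWlaw hWind hF hF2 hF0]
  ring

end TwoSample

/-! ### Independence of the two folds -/

section Folds

variable {Ω 𝒳 𝒴 Θ : Type*} [MeasurableSpace Ω] [MeasurableSpace 𝒳] [MeasurableSpace 𝒴]
  [MeasurableSpace Θ] {n m : ℕ} {μ : Measure Ω} {P : Measure (𝒳 × 𝒴)}
  {Z : Fin n → Ω → 𝒳 × 𝒴} {W : Fin m → Ω → 𝒳} {ξ : Ω → Θ}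

lemma measurable_fold1 (h : IsSemiSupervisedSample μ P Z W ξ) : Measurable (fold1 Z W) := by
  unfold fold1
  exact Measurable.prodMk (measurable_pi_lambda _ fun _ => h.measurable_labeled _)
    (measurable_pi_lambda _ fun _ => h.measurable_unlabeled _)

lemma measurable_fold2 (h : IsSemiSupervisedSample μ P Z W ξ) : Measurable (fold2 Z W) := by
  unfold fold2
  exact Measurable.prodMk (measurable_pi_lambda _ fun _ => h.measurable_labeled _)
    (measurable_pi_lambda _ fun _ => h.measurable_unlabeled _)

variable [IsProbabilityMeasure μ]

lemma indepFun_fold1_fold2 (h : IsSemiSupervisedSample μ P Z W ξ) :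
    IndepFun (fold1 Z W) (fold2 Z W) μ := by
  refine indepFun_prodMk_prodMk_of_indepFun
    (measurable_pi_lambda _ fun i => h.measurable_labeled i)
    (measurable_pi_lambda _ fun i => h.measurable_labeled i)
    (measurable_pi_lambda _ fun j => h.measurable_unlabeled j)
    (measurable_pi_lambda _ fun j => h.measurable_unlabeled j)
    (indepFun_subtype_of_iIndepFun h.measurable_labeled h.indep_labeled _ _ fun i => by omega)
    (indepFun_subtype_of_iIndepFun h.measurable_unlabeled h.indep_unlabeled _ _ fun i => by omega)
    ?_
  have hφ : Measurable fun z : Fin n → 𝒳 × 𝒴 => ((fun i : {i : Fin n // i.val < n / 2} => z i),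
      (fun i : {i : Fin n // n / 2 ≤ i.val} => z i)) :=
    (measurable_pi_lambda _ fun i => measurable_pi_apply _).prodMk
      (measurable_pi_lambda _ fun i => measurable_pi_apply _)
  have hψ : Measurable fun w : Fin m → 𝒳 => ((fun j : {j : Fin m // j.val < m / 2} => w j),
      (fun j : {j : Fin m // m / 2 ≤ j.val} => w j)) :=
    (measurable_pi_lambda _ fun j => measurable_pi_apply _).prodMk
      (measurable_pi_lambda _ fun j => measurable_pi_apply _)
  exact h.indep_labeled_unlabeled.comp hφ hψ

lemma measurable_restrict_folds :
    Measurable fun zw : (Fin n → 𝒳 × 𝒴) × (Fin m → 𝒳) =>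
      (((fun i : {i : Fin n // i.val < n / 2} => zw.1 i),
          (fun j : {j : Fin m // j.val < m / 2} => zw.2 j)),
        ((fun i : {i : Fin n // n / 2 ≤ i.val} => zw.1 i),
          (fun j : {j : Fin m // m / 2 ≤ j.val} => zw.2 j))) := by
  refine (Measurable.prodMk ?_ ?_).prodMk (Measurable.prodMk ?_ ?_)
  · exact measurable_pi_lambda _ fun i => (measurable_pi_apply _).comp measurable_fst
  · exact measurable_pi_lambda _ fun i => (measurable_pi_apply _).comp measurable_snd
  · exact measurable_pi_lambda _ fun i => (measurable_pi_apply _).comp measurable_fst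
  · exact measurable_pi_lambda _ fun i => (measurable_pi_apply _).comp measurable_snd

/-- The seed is grouped with the training fold. Two predictors sharing a seed may be dependent, but
each evaluation fold is still independent of everything its predictor uses. -/
lemma indepFun_fold1_fold2_seed (h : IsSemiSupervisedSample μ P Z W ξ) :
    IndepFun (fold1 Z W) (fun ω => (fold2 Z W ω, ξ ω)) μ :=
  indepFun_prodMk_right_of_indepFun (measurable_fold1 h) (measurable_fold2 h) h.measurable_seed
    (indepFun_fold1_fold2 h) (h.indep_data_seed.comp measurable_restrict_folds measurable_id)

lemma indepFun_fold2_fold1_seed (h : IsSemiSupervisedSample μ P Z W ξ) :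
    IndepFun (fold2 Z W) (fun ω => (fold1 Z W ω, ξ ω)) μ :=
  indepFun_prodMk_right_of_indepFun (measurable_fold2 h) (measurable_fold1 h) h.measurable_seed
    (indepFun_fold1_fold2 h).symm
    (h.indep_data_seed.comp (measurable_swap.comp measurable_restrict_folds) measurable_id)

/-- The cross-fitting error over a fold with labeled indices `p` and unlabeled indices `q`, for a
predictor trained on data independent of the fold. -/
lemma lintegral_sq_fold_error_le (h : IsSemiSupervisedSample μ P Z W ξ) [IsProbabilityMeasure P]
    {p : Fin n → Prop} {q : Fin m → Prop} [DecidablePred p] [DecidablePred q]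
    {α : Type*} [MeasurableSpace α] {T : Ω → α}
    (hT : Measurable T)
    (hind : IndepFun (fun ω => ((fun i : {i // p i} => Z i ω), (fun j : {j // q j} => W j ω))) T μ)
    {fhat : Ω → 𝒳 → ℝ} (htrain : IsTrainedOn T fhat) {f : 𝒳 → ℝ} (hf : Measurable f)
    (hfin : mspe μ P fhat f ≠ ⊤) (a b : ℝ) :
    ∫⁻ ω, ENNReal.ofReal ((a * ∑ i : {i // p i}, (fhat ω (Z i ω).1 - f (Z i ω).1)
        + b * ∑ j : {j // q j}, (fhat ω (W j ω) - f (W j ω))) ^ 2) ∂μ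
      ≤ ENNReal.ofReal (3 * (a ^ 2 * Fintype.card {i // p i} + b ^ 2 * Fintype.card {j // q j}
          + (a * Fintype.card {i // p i} + b * Fintype.card {j // q j}) ^ 2))
        * mspe μ P fhat f := by
  obtain ⟨A, hA, hAf⟩ := htrain
  have hG : Measurable (Function.uncurry fun t x => A t x - f x) :=
    hA.sub (hf.comp measurable_snd)
  unfold mspe at hfin ⊢
  simp_rw [hAf] at hfin ⊢
  have hlawZ : ∀ i, μ.map (fun ω => (Z i ω).1) = P.fst := fun i => by
    rw [Measure.fst, ← h.law_labeled i, Measure.map_map measurable_fst (h.measurable_labeled i)]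
    rfl
  have hmp : Measurable fun z : {i // p i} → 𝒳 × 𝒴 => fun i => (z i).1 :=
    measurable_pi_lambda _ fun i => measurable_fst.comp (measurable_pi_apply i)
  exact lintegral_sq_crossfit_le (ν := P.fst) (G := fun t x => A t x - f x)
    (V := fun (i : {i // p i}) ω => (Z i ω).1) (W := fun (j : {j // q j}) ω => W j ω)
    (fun i => measurable_fst.comp (h.measurable_labeled i)) (fun i => hlawZ i)
    ((h.indep_labeled.comp (fun _ => Prod.fst) fun _ => measurable_fst).precomp
      Subtype.val_injective)
    (fun j => h.measurable_unlabeled j) (fun j => h.law_unlabeled j)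
    (h.indep_unlabeled.precomp Subtype.val_injective) hT
    (hind.comp (hmp.comp measurable_fst) measurable_id)
    (hind.comp measurable_snd measurable_id) hG hfin a b

end Folds

/-! ### Decomposition of the cross-fitted statistic -/

section Decomposition

variable {Ω 𝒳 𝒴 : Type*} {n m r : ℕ}

lemma sum_ite_eq_sum_add_sum_subtype {N : ℕ} (k : ℕ) (u v w : Fin N → ℝ) :
    ∑ i : Fin N, (if i.val < k then u i else v i)
      = ∑ i, w i + ∑ i : {i : Fin N // i.val < k}, (u i - w i)
        + ∑ i : {i : Fin N // k ≤ i.val}, (v i - w i) := by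
  rw [← Finset.sum_subtype (Finset.univ.filter fun i : Fin N => i.val < k) (by simp)
      (fun i => u i - w i),
    ← Finset.sum_subtype (Finset.univ.filter fun i : Fin N => k ≤ i.val) (by simp)
      (fun i => v i - w i), Finset.sum_filter, Finset.sum_filter, ← Finset.sum_add_distrib,
    ← Finset.sum_add_distrib]
  refine Finset.sum_congr rfl fun i _ => ?_
  by_cases h : i.val < k
  · simp [h]
  · simp [h, not_lt.1 h]

variable [MeasurableSpace 𝒳] [MeasurableSpace 𝒴] {P : Measure (𝒳 × 𝒴)} [NeZero r]
  {ℓ : (Fin r → 𝒴) → ℝ} {Z : Fin n → Ω → 𝒳 × 𝒴} {W : Fin m → Ω → 𝒳}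

/-- The scaled statistic is a two-sample linear term plus a degenerate U-statistic plus the
cross-fitting errors over the two folds. -/
lemma scaled_uCross_sub_psi_eq (hn : r ≤ n) (fhat1 fhat2 : Ω → 𝒳 → ℝ) (f : 𝒳 → ℝ) (e s : ℝ)
    (ω : Ω) :
    Real.sqrt n * (uCross ℓ Z W fhat1 fhat2 ω - psi P ℓ) / s
      = (Real.sqrt n / n * ∑ i, r / s * (ell1Y P ℓ (Z i ω) - psi P ℓ
            - (m : ℝ) / (n + m) * (f (Z i ω).1 - e))
          + Real.sqrt n / (n + m) * ∑ j, r / s * (f (W j ω) - e))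
        + (Real.sqrt n / s * uStat (degeneratePart P ℓ) Z ω
          + (-(r / s * (Real.sqrt n / n) * ((m : ℝ) / (n + m)))
              * ∑ i : {i : Fin n // i.val < n / 2}, (fhat2 ω (Z i ω).1 - f (Z i ω).1)
            + r / s * (Real.sqrt n / (n + m))
              * ∑ j : {j : Fin m // j.val < m / 2}, (fhat2 ω (W j ω) - f (W j ω)))
          + (-(r / s * (Real.sqrt n / n) * ((m : ℝ) / (n + m)))
              * ∑ i : {i : Fin n // n / 2 ≤ i.val}, (fhat1 ω (Z i ω).1 - f (Z i ω).1)
            + r / s * (Real.sqrt n / (n + m))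
              * ∑ j : {j : Fin m // m / 2 ≤ j.val}, (fhat1 ω (W j ω) - f (W j ω)))) := by
  have hr : 0 < r := Nat.pos_of_ne_zero (NeZero.ne r)
  have hn0 : (0 : ℝ) < n := by exact_mod_cast hr.trans_le hn
  have hnm : (0 : ℝ) < n + m := by positivity
  have h1 : ∑ i, crossLabeled Z fhat1 fhat2 i ω = _ :=
    sum_ite_eq_sum_add_sum_subtype (n / 2) (fun i => fhat2 ω (Z i ω).1)
      (fun i => fhat1 ω (Z i ω).1) fun i => f (Z i ω).1
  have h2 : ∑ j, crossUnlabeled W fhat1 fhat2 j ω = _ :=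
    sum_ite_eq_sum_add_sum_subtype (m / 2) (fun j => fhat2 ω (W j ω))
      (fun j => fhat1 ω (W j ω)) fun j => f (W j ω)
  have h3 := uStat_sub_psi_eq (P := P) (ℓ := ℓ) (Z := Z) hn ω
  unfold uCross ell1Y
  rw [h1, h2, eq_add_of_sub_eq h3]
  simp only [← Finset.mul_sum, Finset.sum_sub_distrib (f := fun i => _ - psi P ℓ),
    Finset.sum_sub_distrib (f := fun i => f _), Finset.sum_const, Finset.card_univ,
    Fintype.card_fin, nsmul_eq_mul]
  generalize ∑ i : {i : Fin n // i.val < n / 2}, (fhat2 ω (Z i ω).1 - f (Z i ω).1) = a1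
  generalize ∑ j : {j : Fin m // j.val < m / 2}, (fhat2 ω (W j ω) - f (W j ω)) = a2
  generalize ∑ i : {i : Fin n // n / 2 ≤ i.val}, (fhat1 ω (Z i ω).1 - f (Z i ω).1) = a3
  generalize ∑ j : {j : Fin m // m / 2 ≤ j.val}, (fhat1 ω (W j ω) - f (W j ω)) = a4
  generalize ∑ i, f (Z i ω).1 = a5
  generalize ∑ j, f (W j ω) = a6
  rw [Finset.sum_sub_distrib]
  rw [Finset.sum_const, Finset.card_univ, Fintype.card_fin, nsmul_eq_mul]
  generalize ∑ i, ell1 P ℓ (Z i ω).2 = a7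
  -- For `s = 0` both sides are zero by the convention for division.
  rcases eq_or_ne s 0 with hs | hs
  · simp [hs]
  -- The arbitrary centring `e` cancels: over the complete samples the weights −m/(n(n+m)) and
  -- 1/(n+m) sum to zero.
  field_simp
  ring

end Decomposition

/-! ### Weights and sizes of the folds -/

/-- Each of the three terms is at most K², uniformly in m. The delicate one is the squared total
weight K² n ((m₁ − m n₁/n)/(n+m))²: rounding displaces each half by at most 1/2, so the fraction is
at most 1/(2n). Unbalanced folds could make this term of order n. -/
lemma crossfit_weight_le {n m n₁ m₁ K : ℝ} (hn : 1 ≤ n) (hm : 0 ≤ m) (hn₁ : 0 ≤ n₁) (hn₁n : n₁ ≤ n)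
    (hm₁ : 0 ≤ m₁) (hm₁m : m₁ ≤ m) (hn2 : |n₁ - n / 2| ≤ 1 / 2) (hm2 : |m₁ - m / 2| ≤ 1 / 2) :
    3 * ((-(K * (Real.sqrt n / n) * (m / (n + m)))) ^ 2 * n₁ + (K * (Real.sqrt n / (n + m))) ^ 2 * m₁
      + (-(K * (Real.sqrt n / n) * (m / (n + m))) * n₁ + K * (Real.sqrt n / (n + m)) * m₁) ^ 2)
      ≤ 9 * K ^ 2 := by
  have hn0 : 0 < n := by linarith
  have hN : 0 < n + m := by linarith
  have hs : Real.sqrt n ^ 2 = n := Real.sq_sqrt hn0.le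
  have e1 : (-(K * (Real.sqrt n / n) * (m / (n + m)))) ^ 2 * n₁
      = K ^ 2 * ((m / (n + m)) ^ 2 * (n₁ / n)) := by
    have : (-(K * (Real.sqrt n / n) * (m / (n + m)))) ^ 2 * n₁
      = K ^ 2 * (Real.sqrt n ^ 2 * (m / (n + m)) ^ 2 * n₁ / n ^ 2) := by ring
    rw [this, hs]
    field_simp
  have e2 : (K * (Real.sqrt n / (n + m))) ^ 2 * m₁ = K ^ 2 * (n / (n + m) * (m₁ / (n + m))) := by
    have : (K * (Real.sqrt n / (n + m))) ^ 2 * m₁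
      = K ^ 2 * (Real.sqrt n ^ 2 * m₁ / (n + m) ^ 2) := by
      rw [mul_pow, div_pow]
      ring
    rw [this, hs]
    field_simp
  have e3 : (-(K * (Real.sqrt n / n) * (m / (n + m))) * n₁ + K * (Real.sqrt n / (n + m)) * m₁) ^ 2
      = K ^ 2 * (n * ((m₁ - m * n₁ / n) / (n + m)) ^ 2) := by
    have : -(K * (Real.sqrt n / n) * (m / (n + m))) * n₁ + K * (Real.sqrt n / (n + m)) * m₁
      = K * Real.sqrt n * ((m₁ - m * n₁ / n) / (n + m)) := by ring
    rw [this, mul_pow, mul_pow, hs]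
    ring
  have b1 : (m / (n + m)) ^ 2 * (n₁ / n) ≤ 1 :=
    mul_le_one₀ (pow_le_one₀ (by positivity) ((div_le_one hN).2 (by linarith))) (by positivity)
      ((div_le_one hn0).2 hn₁n)
  have b2 : n / (n + m) * (m₁ / (n + m)) ≤ 1 :=
    mul_le_one₀ ((div_le_one hN).2 (by linarith)) (by positivity)
      ((div_le_one hN).2 (by linarith))
  have b3 : n * ((m₁ - m * n₁ / n) / (n + m)) ^ 2 ≤ 1 := by
    have h1 : |m₁ - m * n₁ / n| ≤ (n + m) / (2 * n) := by
      have : m₁ - m * n₁ / n = (m₁ - m / 2) - m / n * (n₁ - n / 2) := by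
        field_simp
        ring
      rw [this]
      refine (abs_sub _ _).trans ?_
      rw [abs_mul, abs_of_nonneg (show 0 ≤ m / n by positivity)]
      calc _ ≤ 1 / 2 + m / n * (1 / 2) := by gcongr
        _ = _ := by field_simp
    have h2 : |(m₁ - m * n₁ / n) / (n + m)| ≤ 1 / (2 * n) := by
      rw [abs_div, abs_of_pos hN, div_le_iff₀ hN]
      refine h1.trans (le_of_eq ?_)
      field_simp
    have h3 : ((m₁ - m * n₁ / n) / (n + m)) ^ 2 ≤ (1 / (2 * n)) ^ 2 := by
      rw [← sq_abs]
      gcongr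
    calc _ ≤ n * (1 / (2 * n)) ^ 2 := by gcongr
      _ = 1 / (4 * n) := by field_simp; norm_num
      _ ≤ 1 := by rw [div_le_one (by positivity)]; linarith
  rw [e1, e2, e3]
  nlinarith [mul_le_mul_of_nonneg_left b1 (sq_nonneg K), mul_le_mul_of_nonneg_left b2 (sq_nonneg K),
    mul_le_mul_of_nonneg_left b3 (sq_nonneg K)]

lemma abs_card_lt_half_sub_le (N : ℕ) :
    |(Fintype.card {i : Fin N // i.val < N / 2} : ℝ) - N / 2| ≤ 1 / 2
      ∧ |(Fintype.card {i : Fin N // N / 2 ≤ i.val} : ℝ) - N / 2| ≤ 1 / 2 := by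
  have h1 : Fintype.card {i : Fin N // i.val < N / 2} = N / 2 := by
    rw [Fintype.card_subtype]
    have := Fin.card_filter_val_lt (n := N) (m := N / 2)
    omega
  have h2 : Fintype.card {i : Fin N // N / 2 ≤ i.val} = N - N / 2 := by
    have h := Fintype.card_subtype_compl fun i : Fin N => i.val < N / 2
    rw [h1, Fintype.card_fin] at h
    rw [← h]
    exact Fintype.card_congr (Equiv.subtypeEquivRight fun i => not_lt.symm)
  rw [h1, h2]
  have hle : N / 2 ≤ N := Nat.div_le_self _ _
  have ha : (2 : ℝ) * ((N / 2 : ℕ) : ℝ) ≤ N := by exact_mod_cast (by omega : 2 * (N / 2) ≤ N)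
  have hb : (N : ℝ) ≤ 2 * ((N / 2 : ℕ) : ℝ) + 1 := by exact_mod_cast (by omega : N ≤ 2 * (N / 2) + 1)
  push_cast [Nat.cast_sub hle]
  constructor <;> rw [abs_le] <;> constructor <;> linarith

/-! ### Measurability of the statistic -/

section Measurability

variable {Ω 𝒳 𝒴 Θ : Type*} [MeasurableSpace Ω] [MeasurableSpace 𝒳] [MeasurableSpace 𝒴]
  [MeasurableSpace Θ] {n m r : ℕ} {μ : Measure Ω} {P : Measure (𝒳 × 𝒴)}
  {Z : Fin n → Ω → 𝒳 × 𝒴} {W : Fin m → Ω → 𝒳} {ξ : Ω → Θ}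

lemma IsTrainedOn.measurable_apply {α : Type*} [MeasurableSpace α] {T : Ω → α}
    {fhat : Ω → 𝒳 → ℝ} (h : IsTrainedOn T fhat) (hT : Measurable T) {X : Ω → 𝒳}
    (hX : Measurable X) : Measurable fun ω => fhat ω (X ω) := by
  obtain ⟨A, hA, hAf⟩ := h
  simp_rw [hAf]
  exact hA.comp (hT.prodMk hX)

lemma measurable_uStat {ℓ : (Fin r → 𝒴) → ℝ} (hℓ : Measurable ℓ) (hZ : ∀ i, Measurable (Z i)) :
    Measurable (uStat ℓ Z) := by
  unfold uStat
  refine Measurable.const_mul (Finset.measurable_fun_sum _ fun e _ => hℓ.comp ?_) _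
  exact measurable_pi_lambda _ fun k => measurable_snd.comp (hZ _)

lemma measurable_uCross {ℓ : (Fin r → 𝒴) → ℝ} (hℓ : Measurable ℓ)
    (h : IsSemiSupervisedSample μ P Z W ξ) {fhat1 fhat2 : Ω → 𝒳 → ℝ}
    (h1 : IsTrainedOn (fun ω => (fold1 Z W ω, ξ ω)) fhat1)
    (h2 : IsTrainedOn (fun ω => (fold2 Z W ω, ξ ω)) fhat2) :
    Measurable (uCross ℓ Z W fhat1 fhat2) := by
  have hT1 := (measurable_fold1 h).prodMk h.measurable_seed
  have hT2 := (measurable_fold2 h).prodMk h.measurable_seed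
  have hL : Measurable fun ω => ∑ i, crossLabeled Z fhat1 fhat2 i ω := by
    refine Finset.measurable_fun_sum _ fun i _ => ?_
    have hX := measurable_fst.comp (h.measurable_labeled i)
    unfold crossLabeled
    split_ifs
    · exact h2.measurable_apply hT2 hX
    · exact h1.measurable_apply hT1 hX
  have hU : Measurable fun ω => ∑ j, crossUnlabeled W fhat1 fhat2 j ω := by
    refine Finset.measurable_fun_sum _ fun j _ => ?_
    have hX := h.measurable_unlabeled j
    unfold crossUnlabeled
    split_ifs
    · exact h2.measurable_apply hT2 hX
    · exact h1.measurable_apply hT1 hX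
  exact ((measurable_uStat hℓ h.measurable_labeled).sub (hL.const_mul _)).add
    ((hL.add hU).const_mul _)

end Measurability

/-! ### Asymptotics of the linear term -/

lemma natCast_mul_sq_sqrt_div_self {n : ℕ} (hn : n ≠ 0) :
    (n : ℝ) * (Real.sqrt n / n) ^ 2 = 1 := by
  have hn' : (n : ℝ) ≠ 0 := Nat.cast_ne_zero.2 hn
  rw [div_pow, Real.sq_sqrt (Nat.cast_nonneg n)]
  field_simp

lemma natCast_mul_sq_sqrt_div_add {n : ℕ} (m : ℕ) (hn : n ≠ 0) :
    (m : ℝ) * (Real.sqrt n / (n + m)) ^ 2 = (m : ℝ) / (n + m) * (1 - (m : ℝ) / (n + m)) := by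
  have hn' : (0 : ℝ) < n := Nat.cast_pos.2 (Nat.pos_of_ne_zero hn)
  have hnm : (0 : ℝ) < (n : ℝ) + m := by positivity
  rw [div_pow, Real.sq_sqrt hn'.le]
  field_simp
  ring

lemma tendsto_sqrt_div_self : Tendsto (fun n : ℕ => Real.sqrt n / n) atTop (𝓝 0) := by
  have h : Tendsto (fun n : ℕ => (Real.sqrt n)⁻¹) atTop (𝓝 0) :=
    tendsto_inv_atTop_zero.comp (Real.tendsto_sqrt_atTop.comp tendsto_natCast_atTop_atTop)
  refine h.congr fun n => ?_
  rw [Real.sqrt_div_self]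

lemma tendsto_sqrt_div_add (m : ℕ → ℕ) :
    Tendsto (fun n : ℕ => Real.sqrt n / ((n : ℝ) + m n)) atTop (𝓝 0) := by
  refine squeeze_zero' (.of_forall fun n => by positivity) ?_ tendsto_sqrt_div_self
  filter_upwards [eventually_gt_atTop 0] with n hn
  have : (0 : ℝ) < n := Nat.cast_pos.2 hn
  gcongr
  linarith [Nat.cast_nonneg (α := ℝ) (m n)]

lemma tendsto_mul_sub_mul {a a' b b' : ℕ → ℂ} (ha : Tendsto (fun n => a n - a' n) atTop (𝓝 0))
    (hb : Tendsto (fun n => b n - b' n) atTop (𝓝 0)) (ha' : ∀ n, ‖a' n‖ ≤ 1) (hbn : ∀ n, ‖b n‖ ≤ 1) :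
    Tendsto (fun n => a n * b n - a' n * b' n) atTop (𝓝 0) := by
  have h := ha.norm.add hb.norm
  rw [norm_zero, add_zero] at h
  refine squeeze_zero_norm (fun n => ?_) h
  have e : a n * b n - a' n * b' n = (a n - a' n) * b n + a' n * (b n - b' n) := by ring
  rw [e]
  refine (norm_add_le _ _).trans (add_le_add ?_ ?_)
  · rw [norm_mul]
    exact mul_le_of_le_one_right (norm_nonneg _) (hbn n)
  · rw [norm_mul]
    exact mul_le_of_le_one_left (norm_nonneg _) (ha' n)

/-- Asymptotic normality of the characteristic function of a standardised two-sample linear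
statistic. -/
lemma tendsto_charFun_two_sample {α β : Type*} [MeasurableSpace α] [MeasurableSpace β]
    {ρ : Measure α} {ν : Measure β} [IsProbabilityMeasure ρ] [IsProbabilityMeasure ν]
    {A : ℕ → α → ℝ} {F : ℕ → β → ℝ} {G : α → ℝ} {H : β → ℝ} (m : ℕ → ℕ)
    (hA : ∀ n, Measurable (A n)) (hF : ∀ n, Measurable (F n)) (hG : MemLp G 2 ρ) (hH : MemLp H 2 ν)
    (hAG : ∀ n a, |A n a| ≤ G a) (hFH : ∀ n b, |F n b| ≤ H b) (hA0 : ∀ n, ∫ a, A n a ∂ρ = 0)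
    (hF0 : ∀ n, ∫ b, F n b ∂ν = 0)
    (hvar : ∀ n : ℕ, n ≠ 0 → (n : ℝ) * (Real.sqrt n / n) ^ 2 * ∫ a, A n a ^ 2 ∂ρ
      + m n * (Real.sqrt n / (n + m n)) ^ 2 * ∫ b, F n b ^ 2 ∂ν = 1) (t : ℝ) :
    Tendsto (fun n : ℕ => charFun (ρ.map (A n)) (Real.sqrt n / n * t) ^ n
      * charFun (ν.map (F n)) (Real.sqrt n / (n + m n) * t) ^ m n) atTop
      (𝓝 (Complex.exp (-t ^ 2 / 2))) := by
  have hc1 : ∀ n : ℕ, (n : ℝ) * (Real.sqrt n / n) ^ 2 ≤ 1 := by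
    intro n
    rcases eq_or_ne n 0 with rfl | hn
    · simp
    · exact (natCast_mul_sq_sqrt_div_self hn).le
  have hd1 : ∀ n : ℕ, (m n : ℝ) * (Real.sqrt n / (n + m n)) ^ 2 ≤ 1 := by
    intro n
    rcases eq_or_ne n 0 with rfl | hn
    · simp
    · rw [natCast_mul_sq_sqrt_div_add _ hn]
      nlinarith [sq_nonneg ((m n : ℝ) / (n + m n) - 1 / 2)]
  have h1 := tendsto_charFun_pow_sub_exp hA hG hAG hA0 tendsto_sqrt_div_self hc1 t
  have h2 := tendsto_charFun_pow_sub_exp hF hH hFH hF0 (tendsto_sqrt_div_add m) hd1 t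
  have h3 := tendsto_mul_sub_mul h1 h2 (fun n => ?_) (fun n => ?_)
  · have h4 := h3.add_const (Complex.exp (-t ^ 2 / 2))
    rw [zero_add] at h4
    refine h4.congr' ?_
    filter_upwards [eventually_ne_atTop 0] with n hn
    rw [← Complex.ofReal_mul, ← Real.exp_add]
    -- The separate variances may oscillate with n; only their sum is fixed, and it makes the
    -- exponents add up exactly.
    have e : -(n * (Real.sqrt n / n * t) ^ 2 * (∫ a, A n a ^ 2 ∂ρ) / 2)
        + -(m n * (Real.sqrt n / (n + m n) * t) ^ 2 * (∫ b, F n b ^ 2 ∂ν) / 2) = -t ^ 2 / 2 := by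
      linear_combination (-t ^ 2 / 2) * hvar n hn
    rw [e]
    push_cast
    ring
  · rw [Complex.norm_real, Real.norm_of_nonneg (Real.exp_pos _).le]
    refine Real.exp_le_one_iff.2 (neg_nonpos.2 ?_)
    have : 0 ≤ ∫ a, A n a ^ 2 ∂ρ := integral_nonneg fun _ => sq_nonneg _
    positivity
  · have := Measure.isProbabilityMeasure_map (hF n).aemeasurable (μ := ν)
    rw [norm_pow]
    exact pow_le_one₀ (norm_nonneg _) (norm_charFun_le_one _)

/-! ### Second moment of the remainder -/

section Remainder

variable {Ω 𝒳 𝒴 Θ : Type*} [MeasurableSpace Ω] [MeasurableSpace 𝒳] [MeasurableSpace 𝒴]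
  [MeasurableSpace Θ] {n m r : ℕ} {μ : Measure Ω} {P : Measure (𝒳 × 𝒴)} [IsProbabilityMeasure μ]
  [IsProbabilityMeasure P] {Z : Fin n → Ω → 𝒳 × 𝒴} {W : Fin m → Ω → 𝒳} {ξ : Ω → Θ}

lemma lintegral_sq_fold1_error_le (h : IsSemiSupervisedSample μ P Z W ξ) (hn : 1 ≤ n)
    {fhat : Ω → 𝒳 → ℝ} (htrain : IsTrainedOn (fun ω => (fold2 Z W ω, ξ ω)) fhat) {f : 𝒳 → ℝ}
    (hf : Measurable f) (hfin : mspe μ P fhat f ≠ ⊤) (K : ℝ) :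
    ∫⁻ ω, ENNReal.ofReal ((-(K * (Real.sqrt n / n) * ((m : ℝ) / (n + m)))
          * ∑ i : {i : Fin n // i.val < n / 2}, (fhat ω (Z i ω).1 - f (Z i ω).1)
        + K * (Real.sqrt n / (n + m))
          * ∑ j : {j : Fin m // j.val < m / 2}, (fhat ω (W j ω) - f (W j ω))) ^ 2) ∂μ
      ≤ ENNReal.ofReal (9 * K ^ 2) * mspe μ P fhat f := by
  refine (lintegral_sq_fold_error_le h ((measurable_fold2 h).prodMk h.measurable_seed)
    (indepFun_fold1_fold2_seed h) htrain hf hfin _ _).trans ?_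
  refine mul_le_mul_left (ENNReal.ofReal_le_ofReal (crossfit_weight_le (by exact_mod_cast hn)
    (Nat.cast_nonneg m) (Nat.cast_nonneg _) ?_ (Nat.cast_nonneg _) ?_ (abs_card_lt_half_sub_le n).1
    (abs_card_lt_half_sub_le m).1)) _
  · exact_mod_cast (Fintype.card_subtype_le _).trans_eq (Fintype.card_fin n)
  · exact_mod_cast (Fintype.card_subtype_le _).trans_eq (Fintype.card_fin m)

lemma lintegral_sq_fold2_error_le (h : IsSemiSupervisedSample μ P Z W ξ) (hn : 1 ≤ n)
    {fhat : Ω → 𝒳 → ℝ} (htrain : IsTrainedOn (fun ω => (fold1 Z W ω, ξ ω)) fhat) {f : 𝒳 → ℝ}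
    (hf : Measurable f) (hfin : mspe μ P fhat f ≠ ⊤) (K : ℝ) :
    ∫⁻ ω, ENNReal.ofReal ((-(K * (Real.sqrt n / n) * ((m : ℝ) / (n + m)))
          * ∑ i : {i : Fin n // n / 2 ≤ i.val}, (fhat ω (Z i ω).1 - f (Z i ω).1)
        + K * (Real.sqrt n / (n + m))
          * ∑ j : {j : Fin m // m / 2 ≤ j.val}, (fhat ω (W j ω) - f (W j ω))) ^ 2) ∂μ
      ≤ ENNReal.ofReal (9 * K ^ 2) * mspe μ P fhat f := by
  refine (lintegral_sq_fold_error_le h ((measurable_fold1 h).prodMk h.measurable_seed)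
    (indepFun_fold2_fold1_seed h) htrain hf hfin _ _).trans ?_
  refine mul_le_mul_left (ENNReal.ofReal_le_ofReal (crossfit_weight_le (by exact_mod_cast hn)
    (Nat.cast_nonneg m) (Nat.cast_nonneg _) ?_ (Nat.cast_nonneg _) ?_ (abs_card_lt_half_sub_le n).2
    (abs_card_lt_half_sub_le m).2)) _
  · exact_mod_cast (Fintype.card_subtype_le _).trans_eq (Fintype.card_fin n)
  · exact_mod_cast (Fintype.card_subtype_le _).trans_eq (Fintype.card_fin m)

variable [NeZero r] {ℓ : (Fin r → 𝒴) → ℝ}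

/-- The second moment of the difference between the scaled statistic and its linear part. -/
lemma lintegral_sq_scaled_remainder_le (hℓ : Measurable ℓ) (hs : IsSymmetricKernel ℓ)
    (hℓ2 : MemLp ℓ 2 (responseLaw P r)) (h : IsSemiSupervisedSample μ P Z W ξ) (hn : r ≤ n)
    (hn2 : 2 ≤ n) {fhat1 fhat2 : Ω → 𝒳 → ℝ}
    (htrain1 : IsTrainedOn (fun ω => (fold1 Z W ω, ξ ω)) fhat1)
    (htrain2 : IsTrainedOn (fun ω => (fold2 Z W ω, ξ ω)) fhat2) {f : 𝒳 → ℝ} (hf : Measurable f)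
    (hfin1 : mspe μ P fhat1 f ≠ ⊤) (hfin2 : mspe μ P fhat2 f ≠ ⊤) (e : ℝ) {s C : ℝ} (hs0 : 0 < s)
    (hC : r / s ≤ C) :
    ∫⁻ ω, ENNReal.ofReal ((Real.sqrt n * (uCross ℓ Z W fhat1 fhat2 ω - psi P ℓ) / s
        - (Real.sqrt n / n * ∑ i, r / s * (ell1Y P ℓ (Z i ω) - psi P ℓ
            - (m : ℝ) / (n + m) * (f (Z i ω).1 - e))
          + Real.sqrt n / (n + m) * ∑ j, r / s * (f (W j ω) - e))) ^ 2) ∂μ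
      ≤ 3 * (ENNReal.ofReal (C ^ 2 * r ^ 4
            * (∫ v, degeneratePart P ℓ v ^ 2 ∂(Measure.pi fun _ => P.snd)) * ((n : ℝ) - 1)⁻¹)
          + ENNReal.ofReal (9 * C ^ 2) * mspe μ P fhat2 f
          + ENNReal.ofReal (9 * C ^ 2) * mspe μ P fhat1 f) := by
  have hr1 : (1 : ℝ) ≤ r := by exact_mod_cast Nat.one_le_iff_ne_zero.2 (NeZero.ne r)
  have hK0 : 0 ≤ r / s := by positivity
  have hKC : (r / s) ^ 2 ≤ C ^ 2 := by gcongr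
  have hn1 : (1 : ℝ) < n := by exact_mod_cast hn2
  simp_rw [scaled_uCross_sub_psi_eq hn fhat1 fhat2 f e s, add_sub_cancel_left]
  have hT1 := (measurable_fold1 h).prodMk h.measurable_seed
  have hT2 := (measurable_fold2 h).prodMk h.measurable_seed
  have hmU := measurable_uStat (measurable_degeneratePart (P := P) hℓ) h.measurable_labeled
  have herr : ∀ {X : Ω → 𝒳}, Measurable X → Measurable fun ω => fhat2 ω (X ω) - f (X ω) :=
    fun hX => (htrain2.measurable_apply hT2 hX).sub (hf.comp hX)
  refine (lintegral_sq_add_add_le (hmU.const_mul _) ?_).trans ?_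
  · refine Measurable.add (Measurable.const_mul (Finset.measurable_fun_sum _ fun i _ => ?_) _)
      (Measurable.const_mul (Finset.measurable_fun_sum _ fun j _ => ?_) _)
    · exact herr (measurable_fst.comp (h.measurable_labeled i))
    · exact herr (h.measurable_unlabeled j)
  refine mul_le_mul_right (add_le_add (add_le_add ?_ ?_) ?_) _
  · rw [lintegral_sq_const_mul]
    refine (mul_le_mul_right (lintegral_sq_uStat_degeneratePart_le hℓ hs hℓ2 h.measurable_labeled
      h.law_labeled h.indep_labeled hn hn2) _).trans ?_
    rw [← ENNReal.ofReal_mul (sq_nonneg _)]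
    refine ENNReal.ofReal_le_ofReal ?_
    set V := ∫ v, degeneratePart P ℓ v ^ 2 ∂(Measure.pi fun _ => P.snd)
    have hV : 0 ≤ V := integral_nonneg fun _ => sq_nonneg _
    -- The degenerate part has no prefactor r, so r ≥ 1 is used to pass from r/s ≤ C to 1/s ≤ C.
    have h1 : (Real.sqrt n / s) ^ 2 ≤ n * C ^ 2 := by
      rw [div_pow, Real.sq_sqrt (by positivity), div_eq_mul_inv]
      gcongr
      refine le_trans ?_ hKC
      rw [div_pow, div_eq_mul_inv]
      exact le_mul_of_one_le_left (by positivity) (one_le_pow₀ hr1)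
    have hn1' : (0 : ℝ) < n - 1 := by linarith
    calc _ ≤ (n * C ^ 2) * (r ^ 4 / (n * (n - 1)) * V) := by gcongr
      _ = _ := by field_simp
  · refine (lintegral_sq_fold1_error_le h (by omega) htrain2 hf hfin2 _).trans ?_
    gcongr
  · refine (lintegral_sq_fold2_error_le h (by omega) htrain1 hf hfin1 _).trans ?_
    gcongr

end Remainder

end SemiSupU

end

theorem mainTheorem1 {𝒳 𝒴 : Type*} [MeasurableSpace 𝒳] [MeasurableSpace 𝒴]
    -- the joint law of `(X, Y)` and a symmetric kernel of order `r ≥ 1`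
    (P : Measure (𝒳 × 𝒴)) [IsProbabilityMeasure P]
    (r : ℕ) [NeZero r] (ℓ : (Fin r → 𝒴) → ℝ) (hℓ_meas : Measurable ℓ)
    (hℓ_symm : SemiSupU.IsSymmetricKernel ℓ)
    -- `Var ℓ(Y₁, …, Y_r) < ∞` and `E[Var(ℓ₁(Y) | X)] > 0`
    (hℓ_var : MemLp ℓ 2 (SemiSupU.responseLaw P r))
    (hℓ_cond : 0 < SemiSupU.expCondVar P ℓ)
    -- an arbitrary sequence of unlabeled sample sizes, and for each `n` a sample
    (m : ℕ → ℕ)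
    {Ω Θ : ℕ → Type*} [∀ n, MeasurableSpace (Ω n)] [∀ n, MeasurableSpace (Θ n)]
    (μ : ∀ n, Measure (Ω n)) [∀ n, IsProbabilityMeasure (μ n)]
    (Z : ∀ n, Fin n → Ω n → 𝒳 × 𝒴) (W : ∀ n, Fin (m n) → Ω n → 𝒳) (ξ : ∀ n, Ω n → Θ n)
    (hsample : ∀ n, SemiSupU.IsSemiSupervisedSample (μ n) P (Z n) (W n) (ξ n))
    -- the predictors, each trained on its own fold (and possibly auxiliary randomness)
    (fhat1 fhat2 : ∀ n, Ω n → 𝒳 → ℝ)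
    (htrain1 : ∀ n,
      SemiSupU.IsTrainedOn (fun ω => (SemiSupU.fold1 (Z n) (W n) ω, ξ n ω)) (fhat1 n))
    (htrain2 : ∀ n,
      SemiSupU.IsTrainedOn (fun ω => (SemiSupU.fold2 (Z n) (W n) ω, ξ n ω)) (fhat2 n))
    -- convergence of both predictors to a fixed `f` with `Var f(X) < ∞`
    (f : 𝒳 → ℝ) (hf_meas : Measurable f) (hf_var : MemLp f 2 P.fst)
    (hmspe1 : Tendsto (fun n => SemiSupU.mspe (μ n) P (fhat1 n) f) atTop (𝓝 0))
    (hmspe2 : Tendsto (fun n => SemiSupU.mspe (μ n) P (fhat2 n) f) atTop (𝓝 0)) :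
    TendstoInDistribution
      (fun (n : ℕ) (ω : Ω n) => Real.sqrt (n : ℝ)
        * (SemiSupU.uCross ℓ (Z n) (W n) (fhat1 n) (fhat2 n) ω - SemiSupU.psi P ℓ)
        / Real.sqrt (SemiSupU.Lam P ℓ f n (m n)))
      atTop (id : ℝ → ℝ) μ (gaussianReal 0 1)
    ∧ Tendsto
      (fun n : ℕ =>
        (∫ ω, (SemiSupU.uCross ℓ (Z n) (W n) (fhat1 n) (fhat2 n) ω - SemiSupU.psi P ℓ) ^ 2 ∂(μ n))
          / ((n : ℝ)⁻¹ * SemiSupU.Lam P ℓ f n (m n)))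
      atTop (𝓝 1) := by
  -- `κ` bounds r/s uniformly in n, by the lower bound on Λ. It scales both the envelopes and the
  -- remainder bound.
  set κ : ℝ := 1 / Real.sqrt (SemiSupU.expCondVar P ℓ) with hκ
  set s : ℕ → ℝ := fun n => Real.sqrt (SemiSupU.Lam P ℓ f n (m n)) with hs
  have hr : (0 : ℝ) < r := Nat.cast_pos.2 (Nat.pos_of_ne_zero (NeZero.ne r))
  have hLam : ∀ n, (r : ℝ) ^ 2 * SemiSupU.expCondVar P ℓ ≤ SemiSupU.Lam P ℓ f n (m n) := fun n =>
    SemiSupU.Lam_ge hℓ_meas hℓ_var hf_var n (m n)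
  have hLam0 : ∀ n, 0 < SemiSupU.Lam P ℓ f n (m n) := fun n =>
    (mul_pos (pow_pos hr 2) hℓ_cond).trans_le (hLam n)
  have hs0 : ∀ n, 0 < s n := fun n => Real.sqrt_pos.2 (hLam0 n)
  have hκs : ∀ n, r / s n ≤ κ := by
    intro n
    have h1 : r * Real.sqrt (SemiSupU.expCondVar P ℓ) ≤ s n := by
      refine Real.le_sqrt_of_sq_le ?_
      rw [mul_pow, Real.sq_sqrt hℓ_cond.le]
      exact hLam n
    rw [hκ, div_le_div_iff₀ (hs0 n) (Real.sqrt_pos.2 hℓ_cond), one_mul]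
    exact h1
  have hK0 : ∀ n, 0 ≤ r / s n := fun n => div_nonneg hr.le (hs0 n).le
  set e : ℝ := ∫ x, f x ∂P.fst with he
  let A : ℕ → 𝒳 × 𝒴 → ℝ := fun n z =>
    r / s n * (SemiSupU.ell1Y P ℓ z - SemiSupU.psi P ℓ - (m n : ℝ) / (n + m n) * (f z.1 - e))
  let F : ℕ → 𝒳 → ℝ := fun n x => r / s n * (f x - e)
  let M : ∀ n, Ω n → ℝ := fun n ω => Real.sqrt n / n * ∑ i, A n (Z n i ω)
    + Real.sqrt n / (n + m n) * ∑ j, F n (W n j ω)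
  let T : ∀ n, Ω n → ℝ := fun n ω => Real.sqrt n
    * (SemiSupU.uCross ℓ (Z n) (W n) (fhat1 n) (fhat2 n) ω - SemiSupU.psi P ℓ) / s n
  have hell : Measurable (SemiSupU.ell1Y P ℓ) :=
    (SemiSupU.measurable_ell1 hℓ_meas).comp measurable_snd
  have hellL : MemLp (fun z => SemiSupU.ell1Y P ℓ z - SemiSupU.psi P ℓ) 2 P :=
    (SemiSupU.memLp_ell1Y hℓ_meas hℓ_var).sub (memLp_const _)
  have hfL : MemLp (fun x => f x - e) 2 P.fst := hf_var.sub (memLp_const _)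
  have hfL' : MemLp (fun z : 𝒳 × 𝒴 => f z.1 - e) 2 P :=
    SemiSupU.memLp_comp_fst (f := fun x => f x - e) hfL
  have hA : ∀ n, Measurable (A n) := fun n => by fun_prop
  have hF : ∀ n, Measurable (F n) := fun n => by fun_prop
  have hA2 : ∀ n, MemLp (A n) 2 P := fun n => (hellL.sub (hfL'.const_mul _)).const_mul _
  have hF2 : ∀ n, MemLp (F n) 2 P.fst := fun n => hfL.const_mul _
  have hf0 : ∫ x, (f x - e) ∂P.fst = 0 := by
    rw [integral_sub (hf_var.integrable (by norm_num)) (integrable_const _)]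
    simp [he]
  have hF0 : ∀ n, ∫ x, F n x ∂P.fst = 0 := fun n => by
    rw [integral_const_mul, hf0, mul_zero]
  have hA0 : ∀ n, ∫ z, A n z ∂P = 0 := fun n => by
    rw [integral_const_mul, integral_sub (hellL.integrable (by norm_num))
      ((hfL'.integrable (by norm_num)).const_mul _), integral_const_mul,
      SemiSupU.integral_fst_eq (f := fun x => f x - e) (hf_meas.sub_const _), hf0,
      integral_sub ((SemiSupU.memLp_ell1Y hℓ_meas hℓ_var).integrable (by norm_num))
        (integrable_const _), SemiSupU.integral_ell1Y hℓ_meas hℓ_var]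
    simp
  have hvar : ∀ n : ℕ, n ≠ 0 → (n : ℝ) * (Real.sqrt n / n) ^ 2 * ∫ z, A n z ^ 2 ∂P
      + m n * (Real.sqrt n / (n + m n)) ^ 2 * ∫ x, F n x ^ 2 ∂P.fst = 1 := by
    intro n hn
    rw [SemiSupU.natCast_mul_sq_sqrt_div_self hn, SemiSupU.natCast_mul_sq_sqrt_div_add _ hn]
    have h1 := SemiSupU.Lam_eq hℓ_meas hℓ_var hf_meas hf_var n (m n)
    simp only [A, F, mul_pow, integral_const_mul]
    -- After multiplication by Λ, the unit-variance claim becomes the identity `Lam_eq` together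
    -- with (r/s)² Λ = r².
    rw [← mul_left_cancel_iff_of_pos (hLam0 n)]
    have h2 : (r / s n) ^ 2 * SemiSupU.Lam P ℓ f n (m n) = r ^ 2 := by
      rw [div_pow, hs, Real.sq_sqrt (hLam0 n).le, div_mul_cancel₀ _ (hLam0 n).ne']
    linear_combination (∫ z, (SemiSupU.ell1Y P ℓ z - SemiSupU.psi P ℓ
      - (m n : ℝ) / (n + m n) * (f z.1 - e)) ^ 2 ∂P + (m n : ℝ) / (n + m n)
        * (1 - (m n : ℝ) / (n + m n)) * ∫ x, (f x - e) ^ 2 ∂P.fst) * h2 - h1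
  have hM : ∀ n, Measurable (M n) := fun n => by
    have h1 := (hsample n).measurable_labeled
    have h2 := (hsample n).measurable_unlabeled
    exact ((Finset.measurable_fun_sum _ fun i _ => (hA n).comp (h1 i)).const_mul _).add
      ((Finset.measurable_fun_sum _ fun j _ => (hF n).comp (h2 j)).const_mul _)
  have hT : ∀ n, Measurable (T n) := fun n =>
    (((SemiSupU.measurable_uCross hℓ_meas (hsample n) (htrain1 n) (htrain2 n)).sub_const
      _).const_mul _).div_const _
  have hM2 : ∀ n, MemLp (M n) 2 (μ n) := fun n =>
    ((SemiSupU.memLp_sum_comp (hsample n).measurable_labeled (hsample n).law_labeled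
      (hA2 n)).const_mul _).add ((SemiSupU.memLp_sum_comp (hsample n).measurable_unlabeled
      (hsample n).law_unlabeled (hF2 n)).const_mul _)
  have hM1 : ∀ n : ℕ, n ≠ 0 → ∫ ω, M n ω ^ 2 ∂(μ n) = 1 := fun n hn => by
    have h := hsample n
    have h2 := SemiSupU.integral_sq_two_sample h.measurable_labeled h.law_labeled h.indep_labeled
      h.measurable_unlabeled h.law_unlabeled h.indep_unlabeled h.indep_labeled_unlabeled (hA n)
      (hA2 n) (hA0 n) (hF n) (hF2 n) (hF0 n) (Real.sqrt n / n) (Real.sqrt n / (n + m n))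
    simp only [Fintype.card_fin] at h2
    exact h2.trans (hvar n hn)
  have hchar : ∀ t : ℝ, Tendsto (fun n => charFun ((μ n).map (M n)) t) atTop
      (𝓝 (Complex.exp (-t ^ 2 / 2))) := by
    intro t
    have h1 := SemiSupU.tendsto_charFun_two_sample (ρ := P) (ν := P.fst)
      (G := fun z => κ * (|SemiSupU.ell1Y P ℓ z - SemiSupU.psi P ℓ| + |f z.1 - e|))
      (H := fun x => κ * |f x - e|) m hA hF ((hellL.abs.add hfL'.abs).const_mul κ)
      (hfL.abs.const_mul κ) (fun n z => ?_) (fun n x => ?_) hA0 hF0 hvar t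
    · refine h1.congr fun n => ?_
      have h := hsample n
      have h2 := SemiSupU.charFun_map_two_sample h.measurable_labeled h.law_labeled
        h.indep_labeled h.measurable_unlabeled h.law_unlabeled h.indep_unlabeled
        h.indep_labeled_unlabeled (hA n) (hF n) (Real.sqrt n / n) (Real.sqrt n / (n + m n)) t
      simp only [Fintype.card_fin] at h2
      exact h2.symm
    · simp only [A]
      rw [abs_mul, abs_of_nonneg (hK0 n)]
      have hl0 : (0 : ℝ) ≤ (m n : ℝ) / (n + m n) := by positivity
      have hl1 : (m n : ℝ) / (n + m n) ≤ 1 :=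
        div_le_one_of_le₀ (by linarith [Nat.cast_nonneg (α := ℝ) n]) (by positivity)
      refine mul_le_mul (hκs n) ((abs_sub _ _).trans (add_le_add le_rfl ?_)) (abs_nonneg _)
        ((hK0 n).trans (hκs n))
      rw [abs_mul, abs_of_nonneg hl0]
      exact mul_le_of_le_one_left (abs_nonneg _) hl1
    · simp only [F]
      rw [abs_mul, abs_of_nonneg (hK0 n)]
      exact mul_le_mul_of_nonneg_right (hκs n) (abs_nonneg _)
  have hR0 : Tendsto (fun n => ∫⁻ ω, ENNReal.ofReal ((T n ω - M n ω) ^ 2) ∂(μ n)) atTop (𝓝 0) := by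
    set V := ∫ v, SemiSupU.degeneratePart P ℓ v ^ 2 ∂(Measure.pi fun _ => P.snd)
    have h1 : Tendsto (fun n : ℕ => ENNReal.ofReal (κ ^ 2 * r ^ 4 * V * ((n : ℝ) - 1)⁻¹)) atTop
        (𝓝 0) := by
      have h : Tendsto (fun n : ℕ => κ ^ 2 * r ^ 4 * V * ((n : ℝ) - 1)⁻¹) atTop (𝓝 0) := by
        have := (tendsto_inv_atTop_zero.comp (tendsto_atTop_add_const_right atTop (-1 : ℝ)
          tendsto_natCast_atTop_atTop)).const_mul (κ ^ 2 * r ^ 4 * V)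
        simpa [sub_eq_add_neg] using this
      simpa using ENNReal.tendsto_ofReal h
    have h2 := ENNReal.Tendsto.const_mul (a := ENNReal.ofReal (9 * κ ^ 2)) hmspe1
      (Or.inr ENNReal.ofReal_ne_top)
    have h3 := ENNReal.Tendsto.const_mul (a := ENNReal.ofReal (9 * κ ^ 2)) hmspe2
      (Or.inr ENNReal.ofReal_ne_top)
    have h4 := ENNReal.Tendsto.const_mul (a := 3) ((h1.add h3).add h2) (by simp)
    simp only [mul_zero, add_zero] at h4
    refine tendsto_of_tendsto_of_tendsto_of_le_of_le' tendsto_const_nhds h4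
      (.of_forall fun n => zero_le) ?_
    -- The prediction errors may be infinite for small n; convergence to zero makes them finite
    -- eventually.
    filter_upwards [eventually_ge_atTop r, eventually_ge_atTop 2,
      hmspe1.eventually (gt_mem_nhds (show (0 : ENNReal) < ⊤ by simp)),
      hmspe2.eventually (gt_mem_nhds (show (0 : ENNReal) < ⊤ by simp))] with n hn hn2 hf1 hf2
    exact SemiSupU.lintegral_sq_scaled_remainder_le hℓ_meas hℓ_symm hℓ_var (hsample n) hn hn2
      (htrain1 n) (htrain2 n) hf_meas hf1.ne hf2.ne e (hs0 n) (hκs n)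
  have hmain := SemiSupU.clt_and_second_moment_of_negligible μ hM (fun n => (hT n).sub (hM n))
    (.of_forall hM2) ((eventually_ne_atTop 0).mono hM1) hR0 hchar
  simp only [Pi.sub_apply, add_sub_cancel] at hmain
  refine ⟨hmain.1, hmain.2.congr' ?_⟩
  -- The squared scaled statistic is n (U_cross − ψ)²/Λ, so its second moment is the required ratio
  -- as soon as n is nonzero.
  filter_upwards [eventually_ne_atTop 0] with n hn
  have hn' : (n : ℝ) ≠ 0 := Nat.cast_ne_zero.2 hn
  rw [← integral_div]
  refine integral_congr_ae (ae_of_all _ fun ω => ?_)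
  simp only [T, hs, div_pow, mul_pow]
  rw [Real.sq_sqrt (hLam0 n).le, Real.sq_sqrt (Nat.cast_nonneg n)]
  field_simp
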